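/- Let $d\in\mathbb N$, let $H_1,\dots,H_d$ be separable real Hilbert spaces and let $L_1,\dots,L_d$ be independent Lévy processes on a common probability space, $L_j$ with values in $H_j$ (a Lévy process starts at $0$, has independent and stationary increments, is stochastically continuous and has càdlàg paths). Let $\Theta=(\Theta_1,\dots,\Theta_d)$ be an $\mathbb R^d$-valued Lévy process, independent of $(L_1,\dots,L_d)$, whose components $\Theta_j$ are subordinators (i.e. have increasing paths). Then the process $X(t):=(L_1(\Theta_1(t)),\dots,L_d(\Theta_d(t)))$, $t\ge 0$, is a Lévy process with values in the Hilbert space $H=H_1\times\dots\times H_d$, equipped with the inner product $\langle u,v\rangle=\sum_{j=1}^d\langle u_j,v_j\rangle_j$. Let $\varphi_j:H_j\to\mathbb C$ be the Lévy exponent of $L_j$, i.e. $\mathbb E\,e^{i\langle L_j(t),u\rangle_j}=e^{t\varphi_j(u)}$ for all $t\ge0$, $u\in H_j$, and let $(a,c,F)$ be the Lévy–Khintchine triplet of $\Theta$ with respect to the truncation function $\chi(x)=x1_{\{|x|\le1\}}$, i.e. $c$ is a symmetric positive semidefinite matrix, $F(\{0\})=0$, $\int \min(1,|x|^2)\,F(dx)<\infty$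 and $$\mathbb E\,e^{i\langle \Theta(1),z\rangle}=\exp\Big(i\langle a,z\rangle-\tfrac12\langle z,cz\rangle+\int_{\mathbb R^d}\big(e^{i\langle x,z\rangle}-1-i\langle\chi(x),z\rangle\big)F(dx)\Big),\qquad z\in\mathbb R^d .$$ Define $a_0:=a-\int_{\mathbb R_+^d}\chi(\theta)\,F(d\theta)$ and the Laplace exponent of $\Theta$ by $$\psi(s)=\sum_{j=1}^d a_{0,j}s_j+\int_{\mathbb R_+^d}\big(e^{\sum_j s_j\theta_j}-1\big)F(d\theta),\qquad s\in(\mathbb R_-+i\mathbb R)^d .$$ These integrals converge absolutely, every $\varphi_j$ takes values in $\mathbb R_-+i\mathbb R$, and the Lévy exponent of $X$ is $\rho(u)=\psi(\varphi_1(u_1),\dots,\varphi_d(u_d))$, that is, $$\mathbb E\,e^{i\langle X(t),u\rangle}=e^{t\rho(u)}\qquad\text{for all }t\ge0,\ u\in H .$$ -/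

import Mathlib

open MeasureTheory ProbabilityTheory Filter Topology
open scoped NNReal ENNReal

noncomputable section

/-- A path is càdlàg: right-continuous with left limits (at time `0` the left limit is no
condition, since `𝓝[<] 0` is trivial in `ℝ≥0`). -/
def IsCadlagPath {E : Type*} [TopologicalSpace E] (f : ℝ≥0 → E) : Prop :=
  ∀ t, ContinuousWithinAt f (Set.Ici t) t ∧ ∃ l, Tendsto f (𝓝[<] t) (𝓝 l)

/-- `X` is a Lévy process under `P`: it starts at `0`, has independent and stationary increments,
is stochastically continuous and has càdlàg paths. Path properties are required almost surely. -/
structure IsLevyProcess {Ω E : Type*} [MeasurableSpace Ω] [NormedAddCommGroup E]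
    [MeasurableSpace E] (X : ℝ≥0 → Ω → E) (P : Measure Ω) : Prop where
  aemeasurable : ∀ t, AEMeasurable (X t) P
  zero : ∀ᵐ ω ∂P, X 0 ω = 0
  indepIncrements : HasIndepIncrements X P
  stationaryIncrements : ∀ s h : ℝ≥0,
    IdentDistrib (fun ω => X (s + h) ω - X s ω) (fun ω => X h ω - X 0 ω) P P
  stochasticallyContinuous : ∀ t, TendstoInMeasure P X (𝓝 t) (X t)
  cadlag : ∀ᵐ ω ∂P, IsCadlagPath (fun t => X t ω)

/-- `φ` is the Lévy exponent of the Hilbert space valued process `X`: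
`E exp (i⟨X t, u⟩) = exp (t φ(u))` for all `t` and `u`. -/
def IsLevyExponent {Ω E : Type*} [MeasurableSpace Ω] [NormedAddCommGroup E]
    [InnerProductSpace ℝ E] (X : ℝ≥0 → Ω → E) (P : Measure Ω) (φ : E → ℂ) : Prop :=
  ∀ (t : ℝ≥0) (u : E),
    ∫ ω, Complex.exp (Complex.I * (inner ℝ (X t ω) u : ℝ)) ∂P = Complex.exp ((t : ℝ) * φ u)

/-- A subordinator: a real-valued Lévy process with (almost surely) increasing paths. -/
def IsSubordinator {Ω : Type*} [MeasurableSpace Ω] (θ : ℝ≥0 → Ω → ℝ) (P : Measure Ω) : Prop :=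
  IsLevyProcess θ P ∧ ∀ᵐ ω ∂P, Monotone (fun t => θ t ω)

/-- An `ℝ^d`-valued subordinator: a Lévy process in `ℝ^d` all of whose components are
subordinators. -/
def IsMultivariateSubordinator {Ω : Type*} [MeasurableSpace Ω] {d : ℕ}
    (Θ : ℝ≥0 → Ω → EuclideanSpace ℝ (Fin d)) (P : Measure Ω) : Prop :=
  IsLevyProcess Θ P ∧ ∀ j, IsSubordinator (fun t ω => Θ t ω j) P

/-- The truncation function `χ(x) = x 1_{|x| ≤ 1}`. -/
def levyTruncation {d : ℕ} (x : EuclideanSpace ℝ (Fin d)) : EuclideanSpace ℝ (Fin d) :=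
  Set.indicator {y | ‖y‖ ≤ 1} id x

/-- `(a, c, F)` is the Lévy–Khintchine triplet (with respect to the truncation function
`levyTruncation`) of the `ℝ^d`-valued Lévy process `Y`: drift `a`, Gaussian covariance `c` and
Lévy measure `F`. -/
structure IsLevyKhintchineTriplet {Ω : Type*} [MeasurableSpace Ω] {d : ℕ}
    (Y : ℝ≥0 → Ω → EuclideanSpace ℝ (Fin d)) (P : Measure Ω)
    (a : EuclideanSpace ℝ (Fin d)) (c : Matrix (Fin d) (Fin d) ℝ)
    (F : Measure (EuclideanSpace ℝ (Fin d))) : Prop where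
  posSemidef : c.PosSemidef
  measure_zero : F {0} = 0
  lintegral_lt_top : ∫⁻ x, ENNReal.ofReal (min 1 (‖x‖ ^ 2)) ∂F < ∞
  charFun_eq : ∀ z : EuclideanSpace ℝ (Fin d),
    ∫ ω, Complex.exp (Complex.I * (inner ℝ (Y 1 ω) z : ℝ)) ∂P =
      Complex.exp (Complex.I * (inner ℝ a z : ℝ)
        - 1 / 2 * (dotProduct z.ofLp (c.mulVec z.ofLp) : ℝ)
        + ∫ x, (Complex.exp (Complex.I * (inner ℝ x z : ℝ)) - 1
            - Complex.I * (inner ℝ (levyTruncation x) z : ℝ)) ∂F)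

/-- The orthant `ℝ_+^d`. -/
def nonnegOrthant (d : ℕ) : Set (EuclideanSpace ℝ (Fin d)) := {θ | ∀ j, 0 ≤ θ j}

/-- `a₀ = a - ∫_{ℝ_+^d} χ(θ) F(dθ)`. -/
def subordinatorDrift {d : ℕ} (a : EuclideanSpace ℝ (Fin d))
    (F : Measure (EuclideanSpace ℝ (Fin d))) : EuclideanSpace ℝ (Fin d) :=
  a - ∫ θ in nonnegOrthant d, levyTruncation θ ∂F

/-- The Laplace exponent `ψ(s) = a₀ s + ∫_{ℝ_+^d} (e^{sθ} - 1) F(dθ)`, of interest for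
`s ∈ (ℝ_- + iℝ)^d`, of a subordinator with drift `a` (relative to the truncation function) and
Lévy measure `F`. -/
def laplaceExponent {d : ℕ} (a : EuclideanSpace ℝ (Fin d))
    (F : Measure (EuclideanSpace ℝ (Fin d))) (s : Fin d → ℂ) : ℂ :=
  ∑ j, (subordinatorDrift a F j : ℂ) * s j
    + ∫ θ in nonnegOrthant d, (Complex.exp (∑ j, s j * (θ j : ℂ)) - 1) ∂F

/-- The multivariate subordinated process `X(t) = (L₁(Θ₁(t)), …, L_d(Θ_d(t)))`, with values in
the Hilbert space `H₁ × ⋯ × H_d` with inner product `⟨u, v⟩ = ∑ j, ⟨u j, v j⟩`. The components of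
a subordinator are almost surely nonnegative, so that `Real.toNNReal` changes nothing. -/
def subordinatedProcess {Ω : Type*} {d : ℕ} {H : Fin d → Type*}
    (L : ∀ j, ℝ≥0 → Ω → H j) (Θ : ℝ≥0 → Ω → EuclideanSpace ℝ (Fin d)) :
    ℝ≥0 → Ω → PiLp 2 H :=
  fun t ω => WithLp.toLp 2 (fun j => L j (Θ t ω j).toNNReal ω)

end

/-! Two mechanisms carry the proof: freezing the time change Θ, and continuing its characteristic
function analytically to its Laplace transform.

As Θ is independent of L, it can be frozen (`integral_randomIndex_of_tendsto_upperGrid`). At fixed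
times, increasing in each coordinate, the mutual independence of the L_j and their independent
stationary increments turn the joint characteristic function of the increments of X into a product
of functions of the increments of Θ. Averaging over Θ, whose increments are independent, keeps the
product (`integral_prod_exp_subordinatedProcess`), and stationarity of Θ passes to X. Paths stay
càdlàg because the time change is monotone (`IsCadlagPath.comp_monotone`); stochastic continuity
then follows from stationarity.

Freezing also gives E exp(i⟨X(t),u⟩) = E exp(∑ φ_j(u_j) Θ_j(t)), so what remains is the Laplace
transform of Θ(t) at complex arguments with nonpositive real parts
(`IsMultivariateSubordinator.integral_exp_eq`). Lévy–Khintchine gives it at imaginary arguments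
only. To make sense of ψ, the weak limit of (n+1)(1 - cos⟨x,h⟩) P(Θ(1/(n+1)) ∈ dx), namely (1 -
cos⟨x,h⟩) F + ½⟨h,ch⟩ δ₀, is tested against suitable functions
(`IsLevyKhintchineTriplet.tendsto_integral`): F lives on the orthant, c = 0, and min(1,|x|) is
F-integrable. The compensator can then be absorbed into the drift, both sides become analytic in one
complex parameter on a half-plane, and Phragmén–Lindelöf carries the identity from the boundary to
the interior. -/

noncomputable section

/-! ### Exponential estimates and analyticity of exponential integrals. -/

section Exponential

lemma norm_exp_sub_one_le_norm {w : ℂ} (hw : w.re ≤ 0) : ‖Complex.exp w - 1‖ ≤ ‖w‖ := by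
  have h := (convex_halfSpace_re_le 0).norm_image_sub_le_of_norm_deriv_le (f := Complex.exp)
    (C := 1) (fun x _ => Complex.differentiable_exp x)
    (fun x hx => by
      rw [Complex.deriv_exp, Complex.norm_exp]
      exact Real.exp_le_one_iff.2 hx)
    (show (0 : ℂ) ∈ {c : ℂ | c.re ≤ 0} by simp) (show w ∈ {c : ℂ | c.re ≤ 0} from hw)
  simpa using h

lemma norm_exp_le_one {w : ℂ} (hw : w.re ≤ 0) : ‖Complex.exp w‖ ≤ 1 := by
  rw [Complex.norm_exp]
  exact Real.exp_le_one_iff.2 hw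

lemma norm_exp_sub_one_le_min {w : ℂ} {C r : ℝ} (hw : w.re ≤ 0) (hC : 0 ≤ C) (hr : 0 ≤ r)
    (h : ‖w‖ ≤ C * r) : ‖Complex.exp w - 1‖ ≤ (2 + C) * min 1 r := by
  rcases le_total 1 r with h1 | h1
  · rw [min_eq_left h1]
    calc ‖Complex.exp w - 1‖ ≤ ‖Complex.exp w‖ + ‖(1 : ℂ)‖ := norm_sub_le _ _
      _ ≤ 1 + 1 := by
        rw [norm_one]
        exact add_le_add_left (norm_exp_le_one hw) 1
      _ ≤ (2 + C) * 1 := by linarith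
  · rw [min_eq_right h1]
    calc ‖Complex.exp w - 1‖ ≤ ‖w‖ := norm_exp_sub_one_le_norm hw
      _ ≤ C * r := h
      _ ≤ (2 + C) * r := by nlinarith

/-- The n-th roots of unity form a finite, hence discrete, set, and a continuous map from a
connected space into it is constant. This selects the right branch of a root. -/
lemma eq_one_of_pow_eq_one_of_continuous {n : ℕ} (hn : 0 < n) {g : ℝ → ℂ} (hg : Continuous g)
    (h1 : ∀ r, g r ^ n = 1) (h0 : g 0 = 1) (r : ℝ) : g r = 1 := by
  have hfin : {z : ℂ | z ^ n = 1}.Finite := by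
    refine (Polynomial.nthRoots n (1 : ℂ)).toFinset.finite_toSet.subset fun z hz => ?_
    simpa [Polynomial.mem_nthRoots hn] using hz
  rw [← h0]
  exact isPreconnected_univ.constant_of_mapsTo hfin.isDiscrete hg.continuousOn
    (fun x _ => h1 x) (Set.mem_univ _) (Set.mem_univ _)

variable {α : Type*} [MeasurableSpace α] {ν : Measure α}

/-- Serves both sides of the Laplace transform identity: ν will be the Lévy measure on the orthant
and the law of Θ(t). -/
lemma diffContOnCl_integral_exp_sub_one {b l : α → ℝ} (hb : Measurable b) (hl : Measurable l)
    (hl0 : ∀ᵐ x ∂ν, 0 ≤ l x) (hint : Integrable (fun x => min 1 (|b x| + l x)) ν) :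
    DiffContOnCl ℂ (fun ζ : ℂ => ∫ x, (Complex.exp (Complex.I * b x - ζ * l x) - 1) ∂ν)
      {ζ | 0 < ζ.re} := by
  have hmeas : ∀ ζ : ℂ,
      AEStronglyMeasurable (fun x => Complex.exp (Complex.I * b x - ζ * l x) - 1) ν :=
    fun ζ => Measurable.aestronglyMeasurable (by fun_prop)
  have hbound : ∀ ζ : ℂ, 0 ≤ ζ.re → ∀ x, 0 ≤ l x →
      ‖Complex.exp (Complex.I * b x - ζ * l x) - 1‖ ≤ (2 + (1 + ‖ζ‖)) * min 1 (|b x| + l x) := by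
    intro ζ hζ x hx
    refine norm_exp_sub_one_le_min ?_ (by positivity) (by positivity) ?_
    · simp only [Complex.sub_re, Complex.mul_re, Complex.I_re, Complex.ofReal_re, Complex.I_im,
        Complex.ofReal_im]
      nlinarith
    · calc ‖Complex.I * b x - ζ * l x‖ ≤ ‖Complex.I * b x‖ + ‖ζ * l x‖ := norm_sub_le _ _
        _ = |b x| + ‖ζ‖ * l x := by simp [abs_of_nonneg hx]
        _ ≤ (1 + ‖ζ‖) * (|b x| + l x) := by
          have := norm_nonneg ζ
          have := abs_nonneg (b x)
          nlinarith [mul_nonneg (norm_nonneg ζ) (abs_nonneg (b x))]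
  constructor
  · intro ζ hζ
    rw [Set.mem_ofPred_eq] at hζ
    refine DifferentiableAt.differentiableWithinAt ?_
    -- On this smaller half-plane the derivative is at most l e^{-l Re ζ/2}, which is bounded by l
    -- and by 2 / Re ζ; together these give an integrable multiple of min(1, |b| + l).
    have hs : {w : ℂ | ζ.re / 2 < w.re} ∈ 𝓝 ζ :=
      (isOpen_lt continuous_const Complex.continuous_re).mem_nhds (by
        rw [Set.mem_ofPred_eq]
        linarith)
    have hder := hasDerivAt_integral_of_dominated_loc_of_deriv_le (μ := ν) (𝕜 := ℂ) (x₀ := ζ)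
      (F := fun (w : ℂ) x => Complex.exp (Complex.I * b x - w * l x) - 1)
      (F' := fun (w : ℂ) x => Complex.exp (Complex.I * b x - w * l x) * (-(l x : ℂ)))
      (bound := fun x => (1 + 2 / ζ.re) * min 1 (|b x| + l x)) hs
      (Eventually.of_forall hmeas) ?_ ?_ ?_ (hint.const_mul _) ?_
    · exact hder.2.differentiableAt
    · refine (hint.const_mul (2 + (1 + ‖ζ‖))).mono' (hmeas ζ) ?_
      filter_upwards [hl0] with x hx using hbound ζ hζ.le x hx
    · exact Measurable.aestronglyMeasurable (by fun_prop)
    · filter_upwards [hl0] with x hx w hw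
      rw [norm_mul, norm_neg, Complex.norm_real, Real.norm_of_nonneg hx, Complex.norm_exp]
      have hre : (Complex.I * b x - w * l x).re ≤ -(ζ.re / 2 * l x) := by
        simp only [Complex.sub_re, Complex.mul_re, Complex.I_re, Complex.ofReal_re, Complex.I_im,
          Complex.ofReal_im]
        nlinarith
      have he := Real.exp_le_exp.2 hre
      have hr : 0 < ζ.re / 2 := by linarith
      have hpos : 0 ≤ ζ.re / 2 * l x := by positivity
      have h1 : Real.exp (-(ζ.re / 2 * l x)) ≤ 1 := Real.exp_le_one_iff.2 (by linarith)
      have h2 : ζ.re / 2 * l x * Real.exp (-(ζ.re / 2 * l x)) ≤ 1 := by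
        rw [Real.exp_neg, ← div_eq_mul_inv, div_le_one (Real.exp_pos _)]
        linarith [Real.add_one_le_exp (ζ.re / 2 * l x)]
      have hc : 0 ≤ 2 / ζ.re := by positivity
      refine (mul_le_mul_of_nonneg_right he hx).trans ?_
      rcases le_total 1 (|b x| + l x) with h | h
      · rw [min_eq_left h, mul_one]
        have : Real.exp (-(ζ.re / 2 * l x)) * l x
            = 2 / ζ.re * (ζ.re / 2 * l x * Real.exp (-(ζ.re / 2 * l x))) := by
          field_simp
        rw [this]
        nlinarith
      · rw [min_eq_right h]
        have hab := abs_nonneg (b x)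
        calc Real.exp (-(ζ.re / 2 * l x)) * l x ≤ 1 * l x := mul_le_mul_of_nonneg_right h1 hx
          _ ≤ (1 + 2 / ζ.re) * (|b x| + l x) := by
            nlinarith [mul_nonneg hc (add_nonneg hab hx)]
    · refine Eventually.of_forall fun x w _ => ?_
      have h1 : HasDerivAt (fun w : ℂ => Complex.I * b x - w * l x) (-(l x : ℂ)) w := by
        simpa using ((hasDerivAt_id w).mul_const (l x : ℂ)).const_sub (Complex.I * b x)
      exact h1.cexp.sub_const 1
  · rw [Complex.closure_setOfPred_lt_re]
    intro ζ hζ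
    refine continuousWithinAt_of_dominated (bound := fun x => (2 + (1 + (‖ζ‖ + 1))) *
      min 1 (|b x| + l x)) (Eventually.of_forall hmeas) ?_ (hint.const_mul _) ?_
    · have hn : ∀ᶠ w in 𝓝[{z : ℂ | 0 ≤ z.re}] ζ, ‖w‖ < ‖ζ‖ + 1 :=
        nhdsWithin_le_nhds (continuous_norm.continuousAt.eventually_lt continuousAt_const
          (lt_add_one _))
      filter_upwards [hn, self_mem_nhdsWithin] with w hw hw0
      filter_upwards [hl0] with x hx
      refine (hbound w hw0 x hx).trans (mul_le_mul_of_nonneg_right (by linarith) ?_)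
      positivity
    · exact Eventually.of_forall fun x => Continuous.continuousWithinAt (by fun_prop)

end Exponential

/-! ### Weak convergence of finite measures. -/

section WeakConvergence

variable {E : Type*} [NormedAddCommGroup E] [InnerProductSpace ℝ E] [MeasurableSpace E]

lemma charFun_normalize {μ : FiniteMeasure E} (hμ : μ ≠ 0) (t : E) :
    charFun (μ.normalize : Measure E) t = (μ.mass : ℂ)⁻¹ * charFun (μ : Measure E) t := by
  rw [FiniteMeasure.toMeasure_normalize_eq_of_nonzero μ hμ, charFun_apply, charFun_apply,
    integral_smul_nnreal_measure, NNReal.smul_def, Complex.real_smul]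
  simp

/-- Lévy's continuity theorem for finite measures. -/
lemma tendsto_integral_of_tendsto_charFun [FiniteDimensional ℝ E] [BorelSpace E] {μ : ℕ → Measure E} [∀ n, IsFiniteMeasure (μ n)]
    {ν : Measure E} [IsFiniteMeasure ν]
    (h : ∀ t, Tendsto (fun n => charFun (μ n) t) atTop (𝓝 (charFun ν t)))
    (g : BoundedContinuousFunction E ℝ) :
    Tendsto (fun n => ∫ x, g x ∂μ n) atTop (𝓝 (∫ x, g x ∂ν)) := by
  let M : ℕ → FiniteMeasure E := fun n => ⟨μ n, inferInstance⟩
  let N : FiniteMeasure E := ⟨ν, inferInstance⟩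
  have hmass : Tendsto (fun n => (M n).mass) atTop (𝓝 N.mass) := by
    have h0 := h 0
    simp only [charFun_zero] at h0
    have h1 := (Complex.continuous_re.tendsto _).comp h0
    rw [← NNReal.tendsto_coe]
    exact h1
  suffices Tendsto M atTop (𝓝 N) from
    (FiniteMeasure.tendsto_iff_forall_integral_tendsto.1 this) g
  -- The zero limit cannot be normalised to a probability measure; there convergence of the masses
  -- alone suffices.
  by_cases hN : N = 0
  · rw [hN] at hmass ⊢
    exact FiniteMeasure.tendsto_zero_of_tendsto_zero_mass (by simpa using hmass)
  refine FiniteMeasure.tendsto_of_tendsto_normalize_testAgainstNN_of_tendsto_mass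
    (ProbabilityMeasure.tendsto_of_tendsto_charFun fun t => ?_) hmass
  have hne : N.mass ≠ 0 := N.mass_nonzero_iff.2 hN
  rw [charFun_normalize hN]
  have hev : ∀ᶠ n in atTop, charFun ((M n).normalize : Measure E) t
      = ((M n).mass : ℂ)⁻¹ * charFun (M n : Measure E) t := by
    filter_upwards [hmass.eventually_ne hne] with n hn
    exact charFun_normalize ((M n).mass_nonzero_iff.1 hn) t
  refine Tendsto.congr' (EventuallyEq.symm hev) (Tendsto.mul (Tendsto.inv₀ ?_ ?_) (h t))
  · exact (Complex.continuous_ofReal.tendsto _).comp ((NNReal.continuous_coe.tendsto _).comp hmass)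
  · exact_mod_cast hne

end WeakConvergence

/-! ### Approximation of times from the right. -/

section UpperGrid

/-- The least multiple of `1 / (n + 1)` that is at least `t`. -/
def upperGrid (n : ℕ) (t : ℝ≥0) : ℝ≥0 := (⌈t * (n + 1)⌉₊ : ℝ≥0) / (n + 1)

lemma le_upperGrid (n : ℕ) (t : ℝ≥0) : t ≤ upperGrid n t := by
  rw [upperGrid, le_div_iff₀ (by positivity)]
  exact Nat.le_ceil _

lemma upperGrid_le (n : ℕ) (t : ℝ≥0) : upperGrid n t ≤ t + 1 / (n + 1) := by
  rw [upperGrid, div_le_iff₀ (by positivity), add_mul, one_div,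
    inv_mul_cancel₀ (by positivity)]
  exact (Nat.ceil_lt_add_one zero_le).le

lemma tendsto_upperGrid (t : ℝ≥0) :
    Tendsto (fun n => upperGrid n t) atTop (𝓝[≥] t) := by
  refine tendsto_nhdsWithin_iff.2 ⟨?_, Eventually.of_forall fun n => le_upperGrid n t⟩
  refine tendsto_of_tendsto_of_tendsto_of_le_of_le tendsto_const_nhds ?_
    (fun n => le_upperGrid n t) (fun n => upperGrid_le n t)
  have h : Tendsto (fun n : ℕ => 1 / ((n : ℝ≥0) + 1)) atTop (𝓝 0) := by
    rw [← NNReal.tendsto_coe]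
    simpa using tendsto_one_div_add_atTop_nhds_zero_nat (𝕜 := ℝ)
  simpa using h.const_add t

end UpperGrid

/-! ### From the law at time 1 to all times. -/

section LevyProcess

variable {Ω E : Type*} [MeasurableSpace Ω] {P : Measure Ω} [NormedAddCommGroup E]
  [MeasurableSpace E] {X : ℝ≥0 → Ω → E}

lemma IsLevyProcess.identDistrib_sub (hX : IsLevyProcess X P) (s h : ℝ≥0) :
    IdentDistrib (fun ω => X (s + h) ω - X s ω) (X h) P P := by
  refine (hX.stationaryIncrements s h).trans ?_
  refine ⟨(hX.stationaryIncrements s h).aemeasurable_snd, hX.aemeasurable h,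
    Measure.map_congr ?_⟩
  filter_upwards [hX.zero] with ω hω
  simp [hω]

lemma IsLevyProcess.tendsto_upperGrid (hX : IsLevyProcess X P) :
    ∀ᵐ ω ∂P, ∀ t, Tendsto (fun n => X (upperGrid n t) ω) atTop (𝓝 (X t ω)) := by
  filter_upwards [hX.cadlag] with ω hω t
  exact (hω t).1.tendsto.comp (_root_.tendsto_upperGrid t)

variable [BorelSpace E] [SecondCountableTopology E]

/-- Stated for any multiplicative f so as to cover both characters and x ↦ e^{-x}. -/
lemma IsLevyProcess.integral_add (hX : IsLevyProcess X P) {f : E → ℂ} (hf : Measurable f)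
    (hmul : ∀ x y, f (x + y) = f x * f y) (s t : ℝ≥0) :
    ∫ ω, f (X (s + t) ω) ∂P = (∫ ω, f (X s ω) ∂P) * ∫ ω, f (X t ω) ∂P := by
  have hind := hX.indepIncrements.indepFun_eval_sub zero_le (le_self_add : s ≤ s + t) hX.zero
  have hid := hX.identDistrib_sub s t
  calc ∫ ω, f (X (s + t) ω) ∂P = ∫ ω, f (X s ω) * f ((X (s + t) - X s) ω) ∂P := by
        refine integral_congr_ae (Eventually.of_forall fun ω => ?_)
        simp [← hmul]
    _ = (∫ ω, f (X s ω) ∂P) * ∫ ω, f ((X (s + t) - X s) ω) ∂P :=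
        hind.integral_fun_comp_mul_comp (hX.aemeasurable s)
          ((hX.aemeasurable _).sub (hX.aemeasurable _)) hf.aestronglyMeasurable
          hf.aestronglyMeasurable
    _ = _ := by
        congr 1
        exact (hid.comp hf).integral_eq

lemma IsLevyProcess.integral_natCast_mul [IsProbabilityMeasure P] (hX : IsLevyProcess X P)
    {f : E → ℂ} (hf : Measurable f)
    (hmul : ∀ x y, f (x + y) = f x * f y) (h0 : f 0 = 1) (n : ℕ) (t : ℝ≥0) :
    ∫ ω, f (X (n * t) ω) ∂P = (∫ ω, f (X t ω) ∂P) ^ n := by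
  induction n with
  | zero =>
    have : (fun ω => f (X 0 ω)) =ᵐ[P] fun _ => 1 := by
      filter_upwards [hX.zero] with ω hω
      rw [hω, h0]
    simp [integral_congr_ae this]
  | succ n ih =>
    rw [Nat.cast_succ, add_mul, one_mul, hX.integral_add hf hmul, ih, pow_succ]

/-- A continuous `Ψ` with `Ψ 0 = 0` and `E exp (i⟨X 1, z⟩) = exp (Ψ z)` is the Lévy exponent. -/
lemma IsLevyProcess.isLevyExponent [IsProbabilityMeasure P] [InnerProductSpace ℝ E]
    (hX : IsLevyProcess X P)
    {Ψ : E → ℂ} (hΨ : Continuous Ψ) (hΨ0 : Ψ 0 = 0)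
    (h1 : ∀ z, ∫ ω, Complex.exp (Complex.I * (inner ℝ (X 1 ω) z : ℝ)) ∂P = Complex.exp (Ψ z)) :
    IsLevyExponent X P Ψ := by
  set φ : ℝ≥0 → E → ℂ := fun t z => ∫ ω, Complex.exp (Complex.I * (inner ℝ (X t ω) z : ℝ)) ∂P
    with hφ
  have hc : ∀ z : E, Continuous fun x : E => Complex.exp (Complex.I * (inner ℝ x z : ℝ)) :=
    fun z => by fun_prop
  have hnorm : ∀ x z : E, ‖Complex.exp (Complex.I * (inner ℝ x z : ℝ))‖ ≤ 1 :=
    fun x z => norm_exp_le_one (by simp)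
  have hmeas : ∀ t z, AEStronglyMeasurable
      (fun ω => Complex.exp (Complex.I * (inner ℝ (X t ω) z : ℝ))) P := fun t z =>
    ((hc z).measurable.comp_aemeasurable (hX.aemeasurable t)).aestronglyMeasurable
  have hpow : ∀ (n : ℕ) (t : ℝ≥0) (z : E), φ (n * t) z = φ t z ^ n := fun n t z =>
    hX.integral_natCast_mul (f := fun x => Complex.exp (Complex.I * (inner ℝ x z : ℝ)))
      (hc z).measurable (fun x y => by
        rw [← Complex.exp_add, inner_add_left]
        push_cast
        ring_nf) (by simp) n t
  have hcont : ∀ t, Continuous (φ t) := fun t =>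
    continuous_of_dominated (bound := fun _ => 1) (hmeas t)
      (fun z => Eventually.of_forall fun ω => hnorm _ _) (integrable_const _)
      (Eventually.of_forall fun ω => by fun_prop)
  have hroot : ∀ (n : ℕ) (z : E), φ (1 / (n + 1)) z = Complex.exp (Ψ z / (n + 1)) := by
    intro n z
    have hn : ((n : ℂ) + 1) ≠ 0 := by exact_mod_cast n.succ_ne_zero
    -- Along the ray r ↦ r • z, the quotient of the characteristic function at time 1/(n+1) by
    -- exp(Ψ/(n+1)) has (n+1)-th power 1 and equals 1 at r = 0, so it is identically 1.
    have key := eq_one_of_pow_eq_one_of_continuous (n := n + 1) n.succ_pos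
      (g := fun r : ℝ => φ (1 / (n + 1)) (r • z) * Complex.exp (-(Ψ (r • z) / (n + 1))))
      (by
        have := hcont (1 / (n + 1))
        fun_prop)
      (fun r => by
        have h := hpow (n + 1) (1 / (n + 1)) (r • z)
        rw [show ((n + 1 : ℕ) : ℝ≥0) * (1 / (n + 1)) = 1 by
          push_cast
          field_simp] at h
        rw [mul_pow, ← h, ← Complex.exp_nat_mul]
        simp only [hφ]
        rw [h1, ← Complex.exp_add]
        push_cast
        rw [show Ψ (r • z) + (n + 1) * -(Ψ (r • z) / (n + 1)) = 0 by
          field_simp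
          ring, Complex.exp_zero])
      (by simp [hφ, hΨ0]) 1
    simp only [one_smul] at key
    rw [Complex.exp_neg] at key
    exact eq_of_mul_inv_eq_one key
  intro t z
  have hl : Tendsto (fun n => φ (upperGrid n t) z) atTop (𝓝 (φ t z)) := by
    refine tendsto_integral_of_dominated_convergence (fun _ => 1) (fun n => hmeas _ z)
      (integrable_const _) (fun n => Eventually.of_forall fun ω => hnorm _ _) ?_
    filter_upwards [hX.tendsto_upperGrid] with ω hω
    exact ((hc z).tendsto _).comp (hω t)
  have hr : Tendsto (fun n => φ (upperGrid n t) z) atTop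
      (𝓝 (Complex.exp ((t : ℝ) * Ψ z))) := by
    have hval : ∀ n, φ (upperGrid n t) z
        = Complex.exp (((upperGrid n t : ℝ≥0) : ℝ) * Ψ z) := by
      intro n
      have h := hpow ⌈t * (n + 1)⌉₊ (1 / (n + 1)) z
      rw [hroot, ← Complex.exp_nat_mul, mul_one_div] at h
      rw [upperGrid, h]
      push_cast
      ring_nf
    simp_rw [hval]
    have hg : Continuous fun s : ℝ≥0 => Complex.exp ((s : ℝ) * Ψ z) := by fun_prop
    exact (hg.tendsto t).comp ((_root_.tendsto_upperGrid t).mono_right nhdsWithin_le_nhds)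
  exact tendsto_nhds_unique hl hr

end LevyProcess

/-! ### Integrals against a real density. -/

section WithDensity

variable {α : Type*} [MeasurableSpace α] {μ : Measure α} {k : α → ℝ}

lemma integral_withDensity_ofReal {G : Type*} [NormedAddCommGroup G] [NormedSpace ℝ G]
    (hk : Measurable k) (h0 : ∀ x, 0 ≤ k x) (g : α → G) :
    ∫ x, g x ∂μ.withDensity (fun x => ENNReal.ofReal (k x)) = ∫ x, k x • g x ∂μ := by
  have h := integral_withDensity_eq_integral_smul (μ := μ) (f := fun x => (k x).toNNReal)
    hk.real_toNNReal g
  simp only [NNReal.smul_def, Real.coe_toNNReal _ (h0 _)] at h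
  exact h

end WithDensity

lemma integral_sub_const_mul_sub_const_mul {α : Type*} [MeasurableSpace α] {μ : Measure α}
    {f g h : α → ℂ} (hf : Integrable f μ) (hg : Integrable g μ) (hh : Integrable h μ) (r s : ℂ) :
    ∫ x, (f x - r * g x - s * h x) ∂μ = ∫ x, f x ∂μ - r * ∫ x, g x ∂μ - s * ∫ x, h x ∂μ := by
  rw [integral_sub (f := fun x => f x - r * g x) (hf.sub (hg.const_mul r)) (hh.const_mul s),
    integral_sub hf (hg.const_mul r), integral_const_mul, integral_const_mul]

/-! ### The Lévy–Khintchine exponent and small-time asymptotics. -/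

section LevyKhintchine

variable {d : ℕ}

/-- The exponent in the Lévy–Khintchine formula. -/
def levyKhintchineExponent (a : EuclideanSpace ℝ (Fin d)) (c : Matrix (Fin d) (Fin d) ℝ)
    (F : Measure (EuclideanSpace ℝ (Fin d))) (z : EuclideanSpace ℝ (Fin d)) : ℂ :=
  Complex.I * (inner ℝ a z : ℝ) - 1 / 2 * (dotProduct z.ofLp (c.mulVec z.ofLp) : ℝ)
    + ∫ x, (Complex.exp (Complex.I * (inner ℝ x z : ℝ)) - 1
      - Complex.I * (inner ℝ (levyTruncation x) z : ℝ)) ∂F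

lemma measurable_levyTruncation : Measurable (levyTruncation (d := d)) :=
  measurable_id.indicator (measurableSet_le measurable_norm measurable_const)

lemma levyTruncation_of_le {x : EuclideanSpace ℝ (Fin d)} (h : ‖x‖ ≤ 1) :
    levyTruncation x = x :=
  Set.indicator_of_mem (s := {y | ‖y‖ ≤ 1}) (f := id) h

lemma levyTruncation_of_lt {x : EuclideanSpace ℝ (Fin d)} (h : 1 < ‖x‖) :
    levyTruncation x = 0 :=
  Set.indicator_of_notMem (s := {y | ‖y‖ ≤ 1}) (f := id) (not_le.2 h)

lemma norm_levyTruncation_le (x : EuclideanSpace ℝ (Fin d)) : ‖levyTruncation x‖ ≤ min 1 ‖x‖ := by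
  rcases le_or_gt ‖x‖ 1 with h | h
  · rw [levyTruncation_of_le h, min_eq_right h]
  · rw [levyTruncation_of_lt h, norm_zero]
    positivity

lemma norm_exp_I_mul_sub_one_sub_le (y : ℝ) :
    ‖Complex.exp (Complex.I * y) - 1 - Complex.I * y‖ ≤ 3 * y ^ 2 := by
  have hn : ‖Complex.I * (y : ℂ)‖ = |y| := by simp
  rcases le_or_gt |y| 1 with h | h
  · have := Complex.norm_exp_sub_one_sub_id_le (x := Complex.I * y) (by rw [hn]; exact h)
    rw [hn, sq_abs] at this
    nlinarith [sq_nonneg y]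
  · calc ‖Complex.exp (Complex.I * y) - 1 - Complex.I * y‖
        ≤ ‖Complex.exp (Complex.I * y) - 1‖ + ‖Complex.I * y‖ := norm_sub_le _ _
      _ ≤ |y| + |y| := by
        rw [hn]
        gcongr
        rw [← hn]
        exact norm_exp_sub_one_le_norm (by simp)
      _ ≤ 3 * y ^ 2 := by
        rw [← sq_abs]
        nlinarith

lemma norm_levyKhintchine_integrand_le (x z : EuclideanSpace ℝ (Fin d)) :
    ‖Complex.exp (Complex.I * (inner ℝ x z : ℝ)) - 1
      - Complex.I * (inner ℝ (levyTruncation x) z : ℝ)‖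
      ≤ (2 + 3 * ‖z‖ ^ 2) * min 1 (‖x‖ ^ 2) := by
  rcases le_or_gt ‖x‖ 1 with h | h
  · rw [levyTruncation_of_le h, min_eq_right (pow_le_one₀ (norm_nonneg x) h)]
    refine (norm_exp_I_mul_sub_one_sub_le _).trans ?_
    have h1 : (inner ℝ x z : ℝ) ^ 2 ≤ (‖x‖ * ‖z‖) ^ 2 := by
      rw [← sq_abs]
      gcongr
      exact abs_real_inner_le_norm x z
    nlinarith [sq_nonneg ‖x‖]
  · rw [levyTruncation_of_lt h, min_eq_left (one_le_pow₀ h.le)]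
    simp only [inner_zero_left, Complex.ofReal_zero, mul_zero, sub_zero, mul_one]
    calc ‖Complex.exp (Complex.I * (inner ℝ x z : ℝ)) - 1‖
        ≤ ‖Complex.exp (Complex.I * (inner ℝ x z : ℝ))‖ + ‖(1 : ℂ)‖ := norm_sub_le _ _
      _ ≤ 1 + 1 := by
        rw [norm_one]
        exact add_le_add_left (norm_exp_le_one (by simp)) 1
      _ ≤ 2 + 3 * ‖z‖ ^ 2 := by nlinarith [sq_nonneg ‖z‖]

lemma measurable_levyKhintchine_integrand (z : EuclideanSpace ℝ (Fin d)) :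
    Measurable fun x => Complex.exp (Complex.I * (inner ℝ x z : ℝ)) - 1
      - Complex.I * (inner ℝ (levyTruncation x) z : ℝ) := by
  have := measurable_levyTruncation (d := d)
  fun_prop

variable {a : EuclideanSpace ℝ (Fin d)} {c : Matrix (Fin d) (Fin d) ℝ}
  {F : Measure (EuclideanSpace ℝ (Fin d))}

lemma integrable_min_one_norm_sq (hF : ∫⁻ x, ENNReal.ofReal (min 1 (‖x‖ ^ 2)) ∂F < ∞) :
    Integrable (fun x => min 1 (‖x‖ ^ 2)) F := by
  refine ⟨Measurable.aestronglyMeasurable (by fun_prop), ?_⟩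
  rwa [hasFiniteIntegral_iff_ofReal (Eventually.of_forall fun x => by positivity)]

lemma integrable_levyKhintchine_integrand (hF : Integrable (fun x => min 1 (‖x‖ ^ 2)) F)
    (z : EuclideanSpace ℝ (Fin d)) :
    Integrable (fun x => Complex.exp (Complex.I * (inner ℝ x z : ℝ)) - 1
      - Complex.I * (inner ℝ (levyTruncation x) z : ℝ)) F :=
  (hF.const_mul (2 + 3 * ‖z‖ ^ 2)).mono' (measurable_levyKhintchine_integrand z).aestronglyMeasurable
    (Eventually.of_forall fun x => norm_levyKhintchine_integrand_le x z)

lemma continuous_levyKhintchineExponent (hF : Integrable (fun x => min 1 (‖x‖ ^ 2)) F) :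
    Continuous (levyKhintchineExponent a c F) := by
  have hint : Continuous fun z : EuclideanSpace ℝ (Fin d) =>
      ∫ x, (Complex.exp (Complex.I * (inner ℝ x z : ℝ)) - 1
        - Complex.I * (inner ℝ (levyTruncation x) z : ℝ)) ∂F := by
    refine continuous_iff_continuousAt.2 fun z => ?_
    refine continuousAt_of_dominated
      (bound := fun x => (2 + 3 * (‖z‖ + 1) ^ 2) * min 1 (‖x‖ ^ 2))
      (Eventually.of_forall fun w => (measurable_levyKhintchine_integrand w).aestronglyMeasurable)
      ?_ (hF.const_mul _) (Eventually.of_forall fun x => Continuous.continuousAt (by fun_prop))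
    filter_upwards [continuous_norm.continuousAt.eventually_lt continuousAt_const
      (lt_add_one ‖z‖)] with w hw
    refine Eventually.of_forall fun x => (norm_levyKhintchine_integrand_le x w).trans ?_
    gcongr
  unfold levyKhintchineExponent dotProduct Matrix.mulVec dotProduct
  fun_prop

lemma levyKhintchineExponent_zero : levyKhintchineExponent a c F 0 = 0 := by
  simp [levyKhintchineExponent]

lemma one_sub_cos_inner_le (x h : EuclideanSpace ℝ (Fin d)) :
    1 - Real.cos (inner ℝ x h) ≤ (2 + ‖h‖ ^ 2) * min 1 (‖x‖ ^ 2) := by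
  rcases le_total 1 (‖x‖ ^ 2) with h1 | h1
  · rw [min_eq_left h1]
    nlinarith [Real.neg_one_le_cos (inner ℝ x h), sq_nonneg ‖h‖]
  · rw [min_eq_right h1]
    have h2 : (inner ℝ x h : ℝ) ^ 2 ≤ (‖x‖ * ‖h‖) ^ 2 := by
      rw [← sq_abs]
      gcongr
      exact abs_real_inner_le_norm x h
    nlinarith [Real.one_sub_sq_div_two_le_cos (x := inner ℝ x h), sq_nonneg ‖x‖]

lemma integrable_one_sub_cos_inner (hF : Integrable (fun x => min 1 (‖x‖ ^ 2)) F)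
    (h : EuclideanSpace ℝ (Fin d)) : Integrable (fun x => 1 - Real.cos (inner ℝ x h)) F := by
  refine (hF.const_mul (2 + ‖h‖ ^ 2)).mono' (Measurable.aestronglyMeasurable (by fun_prop))
    (Eventually.of_forall fun x => ?_)
  rw [Real.norm_of_nonneg (by linarith [Real.cos_le_one (inner ℝ x h)])]
  exact one_sub_cos_inner_le x h

lemma exp_sub_half_exp_add_exp (u v : ℝ) :
    Complex.exp (Complex.I * u) - 1 / 2 * Complex.exp (Complex.I * (u + v : ℝ))
      - 1 / 2 * Complex.exp (Complex.I * (u - v : ℝ))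
      = (1 - Real.cos v : ℝ) * Complex.exp (Complex.I * u) := by
  push_cast
  rw [Complex.cos, mul_add, mul_sub, sub_eq_add_neg (Complex.I * (u : ℂ)), Complex.exp_add,
    Complex.exp_add, neg_mul, mul_comm (v : ℂ)]
  ring

/-- The weights 1, -½, -½ kill everything affine in z: drift, compensator and the constant -1. The
quadratic form leaves only a constant, so the result is the Fourier transform of a finite measure
with an atom at 0. -/
lemma levyKhintchineExponent_second_difference
    (hF : Integrable (fun x => min 1 (‖x‖ ^ 2)) F) (z h : EuclideanSpace ℝ (Fin d)) :
    levyKhintchineExponent a c F z - 1 / 2 * levyKhintchineExponent a c F (z + h)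
      - 1 / 2 * levyKhintchineExponent a c F (z - h)
      = ∫ x, (1 - Real.cos (inner ℝ x h) : ℝ) • Complex.exp (Complex.I * (inner ℝ x z : ℝ)) ∂F
        + (1 / 2 * (dotProduct h.ofLp (c.mulVec h.ofLp)) : ℝ) := by
  have hi := integrable_levyKhintchine_integrand hF
  have hsplit : ∫ x, (1 - Real.cos (inner ℝ x h) : ℝ) •
        Complex.exp (Complex.I * (inner ℝ x z : ℝ)) ∂F
      = ∫ x, (Complex.exp (Complex.I * (inner ℝ x z : ℝ)) - 1
          - Complex.I * (inner ℝ (levyTruncation x) z : ℝ)) ∂F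
        - 1 / 2 * ∫ x, (Complex.exp (Complex.I * (inner ℝ x (z + h) : ℝ)) - 1
          - Complex.I * (inner ℝ (levyTruncation x) (z + h) : ℝ)) ∂F
        - 1 / 2 * ∫ x, (Complex.exp (Complex.I * (inner ℝ x (z - h) : ℝ)) - 1
          - Complex.I * (inner ℝ (levyTruncation x) (z - h) : ℝ)) ∂F := by
    rw [← integral_sub_const_mul_sub_const_mul (hi z) (hi (z + h)) (hi (z - h))]
    refine integral_congr_ae (Eventually.of_forall fun x => ?_)
    have := exp_sub_half_exp_add_exp (inner ℝ x z) (inner ℝ x h)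
    simp only [inner_add_right, inner_sub_right, Complex.real_smul, ← this]
    push_cast
    ring
  rw [hsplit]
  simp only [levyKhintchineExponent, WithLp.ofLp_add, WithLp.ofLp_sub, Matrix.mulVec_add,
    Matrix.mulVec_sub, dotProduct_add, dotProduct_sub, add_dotProduct, sub_dotProduct,
    inner_add_right, inner_sub_right]
  push_cast
  ring

variable {Ω : Type*} [MeasurableSpace Ω] {P : Measure Ω}
  {Y : ℝ≥0 → Ω → EuclideanSpace ℝ (Fin d)}

lemma IsLevyKhintchineTriplet.integrable (hT : IsLevyKhintchineTriplet Y P a c F) :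
    Integrable (fun x => min 1 (‖x‖ ^ 2)) F :=
  integrable_min_one_norm_sq hT.lintegral_lt_top

lemma IsLevyKhintchineTriplet.isLevyExponent [IsProbabilityMeasure P] (hY : IsLevyProcess Y P)
    (hT : IsLevyKhintchineTriplet Y P a c F) :
    IsLevyExponent Y P (levyKhintchineExponent a c F) :=
  hY.isLevyExponent (continuous_levyKhintchineExponent hT.integrable) levyKhintchineExponent_zero
    hT.charFun_eq

lemma IsLevyKhintchineTriplet.dotProduct_mulVec_nonneg (hT : IsLevyKhintchineTriplet Y P a c F)
    (h : Fin d → ℝ) : 0 ≤ dotProduct h (c.mulVec h) := by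
  simpa using hT.posSemidef.dotProduct_mulVec_nonneg h

lemma tendsto_mul_exp_div_sub_one (w : ℂ) :
    Tendsto (fun n : ℕ => ((n : ℂ) + 1) * (Complex.exp (w / (n + 1)) - 1)) atTop (𝓝 w) := by
  have hd : HasDerivAt (fun t : ℂ => Complex.exp (t * w)) w 0 := by
    simpa using ((hasDerivAt_id (0 : ℂ)).mul_const w).cexp
  have hs := hd.tendsto_slope
  have ht : Tendsto (fun n : ℕ => (1 : ℂ) / (n + 1)) atTop (𝓝[≠] 0) := by
    refine tendsto_nhdsWithin_iff.2 ⟨tendsto_one_div_add_atTop_nhds_zero_nat, ?_⟩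
    refine Eventually.of_forall fun n => ?_
    have : (n : ℂ) + 1 ≠ 0 := by exact_mod_cast n.succ_ne_zero
    simp [this]
  refine (hs.comp ht).congr fun n => ?_
  simp [slope_def_field, div_eq_inv_mul, mul_comm]

/-- Weak convergence of the rescaled small-time laws of a Lévy process to its Lévy measure and
Gaussian part. -/
lemma IsLevyKhintchineTriplet.tendsto_integral [IsProbabilityMeasure P] (hY : IsLevyProcess Y P)
    (hT : IsLevyKhintchineTriplet Y P a c F) (h : EuclideanSpace ℝ (Fin d))
    (g : BoundedContinuousFunction (EuclideanSpace ℝ (Fin d)) ℝ) :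
    Tendsto (fun n : ℕ => ∫ ω, ((n : ℝ) + 1) * (1 - Real.cos (inner ℝ (Y (1 / (n + 1)) ω) h))
        * g (Y (1 / (n + 1)) ω) ∂P) atTop
      (𝓝 (∫ x, (1 - Real.cos (inner ℝ x h)) * g x ∂F
        + 1 / 2 * dotProduct h.ofLp (c.mulVec h.ofLp) * g 0)) := by
  have hexp := hT.isLevyExponent hY
  set κ : ℝ := 1 / 2 * dotProduct h.ofLp (c.mulVec h.ofLp) with hκ
  have hκ0 : 0 ≤ κ := mul_nonneg (by norm_num) (hT.dotProduct_mulVec_nonneg _)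
  set k : EuclideanSpace ℝ (Fin d) → ℝ := fun x => 1 - Real.cos (inner ℝ x h) with hk
  have hkm : Measurable k := by fun_prop
  have hk0 : ∀ x, 0 ≤ k x := fun x => by linarith [Real.cos_le_one (inner ℝ x h)]
  have hkF : Integrable k F := integrable_one_sub_cos_inner hT.integrable h
  let kn : ℕ → EuclideanSpace ℝ (Fin d) → ℝ := fun n x => ((n : ℝ) + 1) * k x
  have hknm : ∀ n, Measurable (kn n) := fun n => hkm.const_mul _
  have hkn0 : ∀ n x, 0 ≤ kn n x := fun n x => mul_nonneg (by positivity) (hk0 x)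
  have hYm : ∀ t, AEMeasurable (Y t) P := hY.aemeasurable
  have hprob : ∀ t, IsProbabilityMeasure (P.map (Y t)) :=
    fun t => Measure.isProbabilityMeasure_map (hYm t)
  have hknint : ∀ n (t : ℝ≥0), Integrable (kn n) (P.map (Y t)) := fun n t =>
    (integrable_const (((n : ℝ) + 1) * 2)).mono' (hknm n).aestronglyMeasurable
      (Eventually.of_forall fun x => by
        rw [Real.norm_of_nonneg (hkn0 n x)]
        have : k x ≤ 2 := by linarith [Real.neg_one_le_cos (inner ℝ x h)]
        have hn : (0 : ℝ) ≤ n + 1 := by positivity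
        exact mul_le_mul_of_nonneg_left this hn)
  -- The weight 1 - cos⟨x,h⟩ vanishes quadratically at 0, which makes the limit finite although F
  -- need not be; the Gaussian part survives as a point mass at 0.
  let μ : ℕ → Measure (EuclideanSpace ℝ (Fin d)) := fun n =>
    (P.map (Y (1 / (n + 1)))).withDensity fun x => ENNReal.ofReal (kn n x)
  let ν : Measure (EuclideanSpace ℝ (Fin d)) :=
    F.withDensity (fun x => ENNReal.ofReal (k x)) + ENNReal.ofReal κ • Measure.dirac 0
  have hμfin : ∀ n, IsFiniteMeasure (μ n) := fun n =>
    isFiniteMeasure_withDensity_ofReal (hknint n _).2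
  have hFfin : IsFiniteMeasure (F.withDensity fun x => ENNReal.ofReal (k x)) :=
    isFiniteMeasure_withDensity_ofReal hkF.2
  have hdfin : IsFiniteMeasure (ENNReal.ofReal κ •
      (Measure.dirac 0 : Measure (EuclideanSpace ℝ (Fin d)))) :=
    Measure.smul_finite _ ENNReal.ofReal_ne_top
  have hνfin : IsFiniteMeasure ν := inferInstanceAs (IsFiniteMeasure (_ + _))
  have hνint : ∀ {G : Type} [NormedAddCommGroup G] [NormedSpace ℝ G] [CompleteSpace G]
      (f : EuclideanSpace ℝ (Fin d) → G) (C : ℝ), Continuous f → (∀ x, ‖f x‖ ≤ C) →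
      AEStronglyMeasurable f ν → ∫ x, f x ∂ν = ∫ x, k x • f x ∂F + κ • f 0 := by
    intro G _ _ _ f C hf hC hm
    have hi : Integrable f ν := (integrable_const C).mono' hm (Eventually.of_forall hC)
    rw [integrable_add_measure] at hi
    rw [integral_add_measure hi.1 hi.2, integral_withDensity_ofReal hkm hk0, integral_smul_measure,
      integral_dirac, ENNReal.toReal_ofReal hκ0]
  have hμint : ∀ {G : Type} [NormedAddCommGroup G] [NormedSpace ℝ G] (n : ℕ)
      (f : EuclideanSpace ℝ (Fin d) → G), AEStronglyMeasurable (fun x => kn n x • f x)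
        (P.map (Y (1 / (n + 1)))) →
      ∫ x, f x ∂μ n = ∫ ω, kn n (Y (1 / (n + 1)) ω) • f (Y (1 / (n + 1)) ω) ∂P := by
    intro G _ _ n f hf
    rw [integral_withDensity_ofReal (hknm n) (hkn0 n), integral_map (hYm _) hf]
  have hchar : ∀ z, Tendsto (fun n => charFun (μ n) z) atTop (𝓝 (charFun ν z)) := by
    intro z
    have hce : Continuous fun x : EuclideanSpace ℝ (Fin d) =>
      Complex.exp ((inner ℝ x z : ℝ) * Complex.I) := by fun_prop
    have hν : charFun ν z = levyKhintchineExponent a c F z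
        - 1 / 2 * levyKhintchineExponent a c F (z + h)
        - 1 / 2 * levyKhintchineExponent a c F (z - h) := by
      rw [levyKhintchineExponent_second_difference hT.integrable, charFun_apply,
        hνint _ 1 hce (fun x => norm_exp_le_one (by simp)) hce.aestronglyMeasurable]
      simp [mul_comm, hk, hκ]
    -- Subtracting 1 from each exponential is free, the weights 1, -½, -½ having sum 0, and turns
    -- each term into a difference quotient of exp at 0 with limit the exponent.
    have hμ : ∀ n, charFun (μ n) z =
        ((n : ℂ) + 1) * (Complex.exp (levyKhintchineExponent a c F z / (n + 1)) - 1)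
        - 1 / 2 * (((n : ℂ) + 1) *
          (Complex.exp (levyKhintchineExponent a c F (z + h) / (n + 1)) - 1))
        - 1 / 2 * (((n : ℂ) + 1) *
          (Complex.exp (levyKhintchineExponent a c F (z - h) / (n + 1)) - 1)) := by
      intro n
      have he : ∀ w, ∫ ω, Complex.exp (Complex.I * (inner ℝ (Y (1 / (n + 1)) ω) w : ℝ)) ∂P
          = Complex.exp (levyKhintchineExponent a c F w / (n + 1)) := fun w => by
        rw [hexp (1 / (n + 1)) w]
        push_cast
        ring_nf
      have hi : ∀ w, Integrable
          (fun ω => Complex.exp (Complex.I * (inner ℝ (Y (1 / (n + 1)) ω) w : ℝ))) P := fun w =>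
        (integrable_const (1 : ℝ)).mono'
          ((Continuous.measurable (by fun_prop :
            Continuous fun x : EuclideanSpace ℝ (Fin d) =>
              Complex.exp (Complex.I * (inner ℝ x w : ℝ)))).comp_aemeasurable
            (hYm _)).aestronglyMeasurable
          (Eventually.of_forall fun ω => norm_exp_le_one (by simp))
      have hmeas : Measurable fun x => kn n x • Complex.exp ((inner ℝ x z : ℝ) * Complex.I) :=
        (hknm n).smul hce.measurable
      rw [charFun_apply, hμint n _ hmeas.aestronglyMeasurable]
      have : ∀ ω, kn n (Y (1 / (n + 1)) ω) •
          Complex.exp ((inner ℝ (Y (1 / (n + 1)) ω) z : ℝ) * Complex.I)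
          = ((n : ℂ) + 1) * (Complex.exp (Complex.I * (inner ℝ (Y (1 / (n + 1)) ω) z : ℝ))
            - 1 / 2 * Complex.exp (Complex.I * (inner ℝ (Y (1 / (n + 1)) ω) (z + h) : ℝ))
            - 1 / 2 * Complex.exp (Complex.I * (inner ℝ (Y (1 / (n + 1)) ω) (z - h) : ℝ))) := by
        intro ω
        rw [inner_add_right, inner_sub_right, exp_sub_half_exp_add_exp, Complex.real_smul,
          mul_comm _ Complex.I]
        simp only [kn, hk]
        push_cast
        ring
      simp_rw [this]
      rw [integral_const_mul, integral_sub_const_mul_sub_const_mul (hi z) (hi _) (hi _), he, he, he]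
      ring
    rw [hν]
    simp_rw [hμ]
    exact ((tendsto_mul_exp_div_sub_one _).sub ((tendsto_mul_exp_div_sub_one _).const_mul _)).sub
      ((tendsto_mul_exp_div_sub_one _).const_mul _)
  have hlim := tendsto_integral_of_tendsto_charFun hchar g
  rw [hνint g ‖g‖ g.continuous g.norm_coe_le_norm g.continuous.aestronglyMeasurable] at hlim
  refine hlim.congr fun n => ?_
  exact hμint n g ((hknm n).smul g.continuous.measurable).aestronglyMeasurable

end LevyKhintchine

/-! ### Support, Gaussian part and integrability for a subordinator. -/

section Subordinator

/-- Both 1 - e^{-x} ≥ x/(1+x) and 1 - cos x ≤ 4x²/(1+x) hold for x ≥ 0. After division by x + ε, the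
cosine weight is controlled by the Laplace transform uniformly in ε. -/
lemma one_sub_cos_le_mul {x ε : ℝ} (hx : 0 ≤ x) (hε : 0 ≤ ε) :
    1 - Real.cos x ≤ 4 * (1 - Real.exp (-x)) * (x + ε) := by
  have h1 : x / (1 + x) ≤ 1 - Real.exp (-x) := by
    rw [Real.exp_neg, div_le_iff₀ (by positivity), sub_mul, one_mul]
    have h := Real.add_one_le_exp x
    have : (Real.exp x)⁻¹ * (1 + x) ≤ 1 := by
      rw [inv_mul_le_iff₀ (Real.exp_pos x)]
      linarith
    linarith
  have h2 : 1 - Real.cos x ≤ 4 * (x / (1 + x)) * x := by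
    rw [mul_div_assoc', div_mul_eq_mul_div, le_div_iff₀ (by positivity)]
    rcases le_total x 1 with h | h
    · nlinarith [Real.one_sub_sq_div_two_le_cos (x := x), Real.cos_le_one x, sq_nonneg x,
        mul_nonneg hx (sq_nonneg x)]
    · nlinarith [Real.neg_one_le_cos x]
  have h3 : 0 ≤ x / (1 + x) := by positivity
  nlinarith [mul_nonneg (h3.trans h1) hε, mul_le_mul_of_nonneg_right h1 hx]

lemma sq_le_eight_mul_one_sub_cos {x : ℝ} (hx : |x| ≤ 1) : x ^ 2 ≤ 8 * (1 - Real.cos x) := by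
  have h := Real.cos_le_one_sub_mul_cos_sq (hx.trans (by linarith [Real.pi_gt_three]))
  have hpi : 1 / 8 ≤ 2 / Real.pi ^ 2 := by
    rw [div_le_div_iff₀ (by norm_num) (by positivity)]
    nlinarith [Real.pi_le_four, Real.pi_pos]
  nlinarith [mul_le_mul_of_nonneg_right hpi (sq_nonneg x)]

variable {d : ℕ} {Ω : Type*} [MeasurableSpace Ω] {P : Measure Ω}
  {Θ : ℝ≥0 → Ω → EuclideanSpace ℝ (Fin d)}

lemma IsMultivariateSubordinator.ae_monotone (hΘ : IsMultivariateSubordinator Θ P) :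
    ∀ᵐ ω ∂P, ∀ j, Monotone fun t => Θ t ω j :=
  ae_all_iff.2 fun j => (hΘ.2 j).2

lemma IsMultivariateSubordinator.ae_nonneg (hΘ : IsMultivariateSubordinator Θ P) :
    ∀ᵐ ω ∂P, ∀ t j, 0 ≤ Θ t ω j := by
  filter_upwards [hΘ.ae_monotone, hΘ.1.zero] with ω hω h0 t j
  have := hω j (zero_le (a := t))
  simpa [h0] using this

lemma measurableSet_nonnegOrthant : MeasurableSet (nonnegOrthant d) := by
  have : nonnegOrthant d = ⋂ j, {θ : EuclideanSpace ℝ (Fin d) | 0 ≤ θ j} := by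
    ext θ
    simp [nonnegOrthant]
  rw [this]
  exact MeasurableSet.iInter fun j => measurableSet_le measurable_const (by fun_prop)

/-- The rescaled small-time Laplace transforms of a subordinator are bounded. -/
lemma IsSubordinator.exists_integral_le [IsProbabilityMeasure P] {θ : ℝ≥0 → Ω → ℝ}
    (hθ : IsSubordinator θ P) :
    ∃ C, ∀ n : ℕ, ∫ ω, ((n : ℝ) + 1) * (1 - Real.exp (-θ (1 / (n + 1)) ω)) ∂P ≤ C := by
  have h0 : ∀ᵐ ω ∂P, ∀ t, 0 ≤ θ t ω := by
    filter_upwards [hθ.2, hθ.1.zero] with ω hω h0 t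
    simpa [h0] using hω (zero_le (a := t))
  have hint : ∀ t, Integrable (fun ω => Real.exp (-θ t ω)) P := fun t => by
    refine (integrable_const (1 : ℝ)).mono'
      (Real.measurable_exp.comp_aemeasurable (hθ.1.aemeasurable t).neg).aestronglyMeasurable ?_
    filter_upwards [h0] with ω hω
    rw [Real.norm_of_nonneg (Real.exp_nonneg _)]
    exact Real.exp_le_one_iff.2 (by linarith [hω t])
  have hpos : ∀ t, 0 < ∫ ω, Real.exp (-θ t ω) ∂P := fun t => integral_exp_pos (hint t)
  -- With y = E e^{-θ(1/(n+1))} one has y^{n+1} = E e^{-θ(1)}, so (n+1)(1 - y) ≤ -(n+1) log y is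
  -- this constant.
  refine ⟨-Real.log (∫ ω, Real.exp (-θ 1 ω) ∂P), fun n => ?_⟩
  have hpow := hθ.1.integral_natCast_mul (f := fun x : ℝ => ((Real.exp (-x) : ℝ) : ℂ))
    (by fun_prop) (fun x y => by rw [neg_add, Real.exp_add, Complex.ofReal_mul]) (by simp)
    (n + 1) (1 / (n + 1))
  rw [integral_complex_ofReal, integral_complex_ofReal, ← Complex.ofReal_pow,
    Complex.ofReal_inj, show ((n + 1 : ℕ) : ℝ≥0) * (1 / (n + 1)) = 1 by
      push_cast
      field_simp] at hpow
  rw [hpow, Real.log_pow, integral_const_mul, integral_sub (integrable_const _) (hint _)]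
  have := Real.log_le_sub_one_of_pos (hpos (1 / (n + 1)))
  simp only [integral_const, probReal_univ, smul_eq_mul, mul_one]
  push_cast
  nlinarith [(Nat.cast_nonneg n : (0 : ℝ) ≤ n)]

variable [IsProbabilityMeasure P] {a : EuclideanSpace ℝ (Fin d)} {c : Matrix (Fin d) (Fin d) ℝ}
  {F : Measure (EuclideanSpace ℝ (Fin d))}

lemma inner_single_eq_mul (x : EuclideanSpace ℝ (Fin d)) (j : Fin d) (r : ℝ) :
    (inner ℝ x (EuclideanSpace.single j r) : ℝ) = r * x j := by
  simp [EuclideanSpace.inner_single_right]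

/-- The Lévy measure of a multivariate subordinator is concentrated on the orthant. -/
lemma IsMultivariateSubordinator.ae_mem_nonnegOrthant (hΘ : IsMultivariateSubordinator Θ P)
    (hT : IsLevyKhintchineTriplet Θ P a c F) : ∀ᵐ x ∂F, x ∈ nonnegOrthant d := by
  refine ae_all_iff.2 fun j => ?_
  -- This g vanishes where x_j ≥ 0: every prelimit integral is zero, and so is the Gaussian
  -- contribution g(0).
  let g : BoundedContinuousFunction (EuclideanSpace ℝ (Fin d)) ℝ :=
    BoundedContinuousFunction.ofNormedAddCommGroup (fun x => min 1 (max 0 (-x j))) (by fun_prop) 1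
      (fun x => by
        rw [Real.norm_of_nonneg (by positivity)]
        exact min_le_left _ _)
  have hg : ∀ x, g x = min 1 (max 0 (-x j)) := fun x => rfl
  have hg0 : ∀ x, 0 ≤ g x := fun x => by
    rw [hg]
    positivity
  -- The cosine weight alone would miss points with x_j in 2πℤ. With h = e_j/(k+1) and k ≥ |x_j| the
  -- angle is below 1 in absolute value, so the weight vanishes only at x_j = 0.
  have hk : ∀ k : ℕ, ∀ᵐ x ∂F, (1 - Real.cos (1 / (k + 1) * x j)) * g x = 0 := by
    intro k
    set h := EuclideanSpace.single j (1 / ((k : ℝ) + 1)) with hh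
    have hlim := hT.tendsto_integral hΘ.1 h g
    have hz : ∀ n : ℕ, ∫ ω, ((n : ℝ) + 1) * (1 - Real.cos (inner ℝ (Θ (1 / (n + 1)) ω) h))
        * g (Θ (1 / (n + 1)) ω) ∂P = 0 := by
      intro n
      refine integral_eq_zero_of_ae ?_
      filter_upwards [hΘ.ae_nonneg] with ω hω
      have := hω (1 / (n + 1)) j
      rw [hg, max_eq_left (by linarith)]
      simp
    simp_rw [hz] at hlim
    have h1 := tendsto_nhds_unique tendsto_const_nhds hlim
    have hg00 : g 0 = 0 := by simp [hg]
    rw [hg00, mul_zero, add_zero] at h1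
    have hi : Integrable (fun x => (1 - Real.cos (inner ℝ x h)) * g x) F := by
      refine (integrable_one_sub_cos_inner hT.integrable h).mul_bdd (c := 1)
        g.continuous.measurable.aestronglyMeasurable (Eventually.of_forall fun x => ?_)
      rw [Real.norm_of_nonneg (hg0 x), hg]
      exact min_le_left _ _
    have h2 := (integral_eq_zero_iff_of_nonneg (fun x => mul_nonneg
      (by linarith [Real.cos_le_one (inner ℝ x h)]) (hg0 x)) hi).1 h1.symm
    filter_upwards [h2] with x hx
    rw [hh, inner_single_eq_mul] at hx
    exact hx
  filter_upwards [ae_all_iff.2 hk] with x hx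
  by_contra hneg
  rw [not_le] at hneg
  obtain ⟨k, hkx⟩ := exists_nat_ge |x j|
  have hgx : g x ≠ 0 := by
    rw [hg]
    exact (lt_min one_pos (lt_max_of_lt_right (by linarith))).ne'
  have hcos : Real.cos (1 / (k + 1) * x j) = 1 := by
    rcases mul_eq_zero.1 (hx k) with h | h
    · linarith
    · exact absurd h hgx
  have hk1 : (0 : ℝ) < k + 1 := by positivity
  have habs : |1 / ((k : ℝ) + 1) * x j| < 1 := by
    rw [abs_mul, abs_of_pos (by positivity), one_div, inv_mul_lt_iff₀ hk1]
    linarith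
  rw [abs_lt] at habs
  rw [Real.cos_eq_one_iff_of_lt_of_lt (by linarith [Real.pi_gt_three])
    (by linarith [Real.pi_gt_three])] at hcos
  rcases mul_eq_zero.1 hcos with h | h
  · exact absurd h (by positivity)
  · exact hneg.ne h

/-- The limit theorem is tested with 1/(|x_j| + ε). Since C does not depend on ε, letting ε → 0 both
forces c_jj = 0 and bounds the integral of (1 - cos x_j)/|x_j|. -/
lemma IsMultivariateSubordinator.exists_integral_add_le (hΘ : IsMultivariateSubordinator Θ P)
    (hT : IsLevyKhintchineTriplet Θ P a c F) (j : Fin d) :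
    ∃ C, ∀ ε > 0, ∫ x, (1 - Real.cos (x j)) * (|x j| + ε)⁻¹ ∂F + 1 / 2 * c j j * ε⁻¹ ≤ C := by
  obtain ⟨C, hC⟩ := (hΘ.2 j).exists_integral_le
  refine ⟨4 * C, fun ε hε => ?_⟩
  have hpos : ∀ x : EuclideanSpace ℝ (Fin d), 0 < |x j| + ε := fun x => by positivity
  let g : BoundedContinuousFunction (EuclideanSpace ℝ (Fin d)) ℝ :=
    BoundedContinuousFunction.ofNormedAddCommGroup (fun x => (|x j| + ε)⁻¹)
      (Continuous.inv₀ (by fun_prop) fun x => (hpos x).ne') ε⁻¹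
      (fun x => by
        rw [Real.norm_of_nonneg (inv_nonneg.2 (hpos x).le)]
        exact inv_anti₀ hε (by linarith [abs_nonneg (x j)]))
  have hg : ∀ x, g x = (|x j| + ε)⁻¹ := fun x => rfl
  have hlim := hT.tendsto_integral hΘ.1 (EuclideanSpace.single j 1) g
  have hval : dotProduct (EuclideanSpace.single j (1 : ℝ)).ofLp
      (c.mulVec (EuclideanSpace.single j (1 : ℝ)).ofLp) = c j j := by
    simp
  have hg0 : g 0 = ε⁻¹ := by simp [hg]
  rw [hval, hg0] at hlim
  simp only [inner_single_eq_mul, one_mul] at hlim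
  refine le_of_tendsto hlim (Eventually.of_forall fun n => ?_)
  refine le_trans ?_ (mul_le_mul_of_nonneg_left (hC n) (by norm_num : (0 : ℝ) ≤ 4))
  rw [← integral_const_mul]
  have hnn : ∀ ω, 0 ≤ ((n : ℝ) + 1) * (1 - Real.cos (Θ (1 / (n + 1)) ω j))
      * g (Θ (1 / (n + 1)) ω) := fun ω => by
    refine mul_nonneg (mul_nonneg (by positivity) ?_) (inv_nonneg.2 (hpos _).le)
    linarith [Real.cos_le_one (Θ (1 / (n + 1)) ω j)]
  refine integral_mono_of_nonneg (Eventually.of_forall hnn) ?_ ?_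
  · have hm := ((hΘ.2 j).1.aemeasurable (1 / (n + 1)))
    refine (integrable_const (4 * (((n : ℝ) + 1) * 1))).mono'
      (AEMeasurable.aestronglyMeasurable (by fun_prop)) ?_
    filter_upwards [hΘ.ae_nonneg] with ω hω
    have h1 : Real.exp (-Θ (1 / (n + 1)) ω j) ≤ 1 :=
      Real.exp_le_one_iff.2 (by linarith [hω (1 / (n + 1)) j])
    have h2 := Real.exp_pos (-Θ (1 / (n + 1)) ω j)
    have hn : (0 : ℝ) ≤ n + 1 := by positivity
    rw [Real.norm_of_nonneg (mul_nonneg (by norm_num) (mul_nonneg hn (by linarith)))]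
    gcongr
    linarith
  · filter_upwards [hΘ.ae_nonneg] with ω hω
    have h1 := one_sub_cos_le_mul (hω (1 / (n + 1)) j) hε.le
    have hp := hpos (Θ (1 / (n + 1)) ω)
    rw [hg, ← div_eq_mul_inv, div_le_iff₀ hp, abs_of_nonneg (hω (1 / (n + 1)) j)]
    have hn : (0 : ℝ) ≤ n + 1 := by positivity
    nlinarith [mul_le_mul_of_nonneg_left h1 hn]

/-- A multivariate subordinator has no Gaussian part. -/
lemma IsMultivariateSubordinator.gaussianPart_eq_zero (hΘ : IsMultivariateSubordinator Θ P)
    (hT : IsLevyKhintchineTriplet Θ P a c F) : c = 0 := by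
  rw [← hT.posSemidef.trace_eq_zero_iff]
  refine Finset.sum_eq_zero fun j _ => ?_
  rw [Matrix.diag_apply]
  obtain ⟨C, hC⟩ := hΘ.exists_integral_add_le hT j
  have h0 : 0 ≤ c j j := hT.posSemidef.diag_nonneg
  have hle : ∀ ε > 0, c j j ≤ 2 * C * ε := fun ε hε => by
    have h1 : 0 ≤ ∫ x, (1 - Real.cos (x j)) * (|x j| + ε)⁻¹ ∂F := integral_nonneg fun x =>
      mul_nonneg (by linarith [Real.cos_le_one (x j)]) (by positivity)
    have h2 : 1 / 2 * c j j * ε⁻¹ ≤ C := by linarith [hC ε hε]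
    rw [← div_eq_mul_inv, div_le_iff₀ hε] at h2
    linarith
  refine le_antisymm ?_ h0
  have ht : Tendsto (fun ε : ℝ => 2 * C * ε) (𝓝[>] 0) (𝓝 0) :=
    (Continuous.tendsto' (by fun_prop) 0 0 (by simp)).mono_left nhdsWithin_le_nhds
  exact ge_of_tendsto ht (eventually_nhdsWithin_of_forall hle)

/-- Fatou's lemma along ε = 1/(n+1). At x_j = 0 all integrands vanish thanks to the cosine factor,
so the convention 0⁻¹ = 0 is harmless. -/
lemma IsMultivariateSubordinator.integrable_one_sub_cos_mul_inv_abs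
    (hΘ : IsMultivariateSubordinator Θ P) (hT : IsLevyKhintchineTriplet Θ P a c F) (j : Fin d) :
    Integrable (fun x => (1 - Real.cos (x j)) * |x j|⁻¹) F := by
  obtain ⟨C, hC⟩ := hΘ.exists_integral_add_le hT j
  have hcos : ∀ y : ℝ, 0 ≤ 1 - Real.cos y := fun y => by linarith [Real.cos_le_one y]
  have hm : ∀ ε : ℝ, Measurable fun x : EuclideanSpace ℝ (Fin d) =>
      (1 - Real.cos (x j)) * (|x j| + ε)⁻¹ := fun ε => by fun_prop
  have hm0 : Measurable fun x : EuclideanSpace ℝ (Fin d) =>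
      (1 - Real.cos (x j)) * |x j|⁻¹ := by fun_prop
  have h0 : 0 ≤ c j j := hT.posSemidef.diag_nonneg
  refine ⟨hm0.aestronglyMeasurable, ?_⟩
  rw [hasFiniteIntegral_iff_ofReal (Eventually.of_forall fun x =>
    mul_nonneg (hcos _) (by positivity))]
  let ε : ℕ → ℝ := fun n => 1 / ((n : ℝ) + 1)
  have hε : ∀ n, 0 < ε n := fun n => by positivity
  have hlim : ∀ x : EuclideanSpace ℝ (Fin d), Tendsto
      (fun n => ENNReal.ofReal ((1 - Real.cos (x j)) * (|x j| + ε n)⁻¹)) atTop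
      (𝓝 (ENNReal.ofReal ((1 - Real.cos (x j)) * |x j|⁻¹))) := by
    intro x
    refine (ENNReal.continuous_ofReal.tendsto _).comp ?_
    by_cases hx : x j = 0
    · simp [hx]
    · have ht : Tendsto (fun n => |x j| + ε n) atTop (𝓝 |x j|) := by
        simpa [ε] using (tendsto_one_div_add_atTop_nhds_zero_nat (𝕜 := ℝ)).const_add |x j|
      exact (ht.inv₀ (by simpa using hx)).const_mul _
  have hbound : ∀ n, ∫⁻ x, ENNReal.ofReal ((1 - Real.cos (x j)) * (|x j| + ε n)⁻¹) ∂F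
      ≤ ENNReal.ofReal C := by
    intro n
    have hi : Integrable (fun x : EuclideanSpace ℝ (Fin d) =>
        (1 - Real.cos (x j)) * (|x j| + ε n)⁻¹) F := by
      have := integrable_one_sub_cos_inner hT.integrable (EuclideanSpace.single j 1)
      simp only [inner_single_eq_mul, one_mul] at this
      refine this.mul_bdd (c := (ε n)⁻¹) (Measurable.aestronglyMeasurable (by fun_prop))
        (Eventually.of_forall fun x => ?_)
      have hx := hε n
      rw [Real.norm_of_nonneg (by positivity)]
      exact inv_anti₀ (hε n) (by linarith [abs_nonneg (x j)])
    rw [← ofReal_integral_eq_lintegral_ofReal hi (Eventually.of_forall fun x =>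
      mul_nonneg (hcos _) (by have := hε n; positivity))]
    refine ENNReal.ofReal_le_ofReal ?_
    have h1 : 0 ≤ 1 / 2 * c j j * (ε n)⁻¹ := by
      have := hε n
      positivity
    linarith [hC (ε n) (hε n)]
  calc ∫⁻ x, ENNReal.ofReal ((1 - Real.cos (x j)) * |x j|⁻¹) ∂F
      = ∫⁻ x, liminf (fun n => ENNReal.ofReal ((1 - Real.cos (x j)) * (|x j| + ε n)⁻¹)) atTop ∂F :=
        lintegral_congr fun x => (hlim x).liminf_eq.symm
    _ ≤ liminf (fun n => ∫⁻ x, ENNReal.ofReal ((1 - Real.cos (x j)) * (|x j| + ε n)⁻¹) ∂F) atTop :=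
        lintegral_liminf_le fun n => (hm (ε n)).ennreal_ofReal
    _ ≤ ENNReal.ofReal C := by
        refine liminf_le_of_le (by isBoundedDefault) fun b hb => ?_
        obtain ⟨n, hn⟩ := hb.exists
        exact hn.trans (hbound n)
    _ < ∞ := ENNReal.ofReal_lt_top

lemma norm_le_sum_abs (x : EuclideanSpace ℝ (Fin d)) : ‖x‖ ≤ ∑ j, |x j| := by
  rw [EuclideanSpace.norm_eq]
  refine Real.sqrt_le_iff.2 ⟨Finset.sum_nonneg fun j _ => abs_nonneg _, ?_⟩
  simpa using Finset.sum_sq_le_sq_sum_of_nonneg (s := Finset.univ) (f := fun j => |x j|)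
    fun j _ => abs_nonneg _

/-- The Lévy measure of a multivariate subordinator integrates `min 1 ‖x‖`. -/
lemma IsMultivariateSubordinator.integrable_min_one_norm (hΘ : IsMultivariateSubordinator Θ P)
    (hT : IsLevyKhintchineTriplet Θ P a c F) : Integrable (fun x => min 1 ‖x‖) F := by
  have hs : Integrable (fun x => ∑ j, (1 - Real.cos (x j)) * |x j|⁻¹) F :=
    integrable_finsetSum _ fun j _ => hΘ.integrable_one_sub_cos_mul_inv_abs hT j
  -- The first summand dominates where |x| ≥ 1. Where |x| ≤ 1, the bound x_j² ≤ 8(1 - cos x_j) gives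
  -- |x_j| ≤ 8(1 - cos x_j)/|x_j|, and |x| ≤ ∑ |x_j|.
  refine (hT.integrable.add (hs.const_mul 8)).mono'
    (Measurable.aestronglyMeasurable (by fun_prop)) (Eventually.of_forall fun x => ?_)
  have hnn : ∀ j, 0 ≤ (1 - Real.cos (x j)) * |x j|⁻¹ := fun j =>
    mul_nonneg (by linarith [Real.cos_le_one (x j)]) (by positivity)
  have hsn : 0 ≤ ∑ j, (1 - Real.cos (x j)) * |x j|⁻¹ := Finset.sum_nonneg fun j _ => hnn j
  rw [Real.norm_of_nonneg (by positivity), Pi.add_apply]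
  rcases le_total 1 ‖x‖ with h | h
  · rw [min_eq_left h, min_eq_left (one_le_pow₀ h)]
    linarith
  · rw [min_eq_right h]
    have h1 : ‖x‖ ≤ 8 * ∑ j, (1 - Real.cos (x j)) * |x j|⁻¹ := by
      refine (norm_le_sum_abs x).trans ?_
      rw [Finset.mul_sum]
      refine Finset.sum_le_sum fun j _ => ?_
      have hj : |x j| ≤ 1 := (PiLp.norm_apply_le x j).trans h
      by_cases hx : x j = 0
      · simp [hx]
      · have hp : 0 < |x j| := abs_pos.2 hx
        rw [← mul_assoc, ← div_eq_mul_inv, le_div_iff₀ hp, ← sq, sq_abs]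
        exact sq_le_eight_mul_one_sub_cos hj
    have h2 : 0 ≤ min 1 (‖x‖ ^ 2) := by positivity
    linarith

end Subordinator

/-! ### The Laplace exponent and analytic continuation. -/

section LaplaceExponent

variable {d : ℕ} {F : Measure (EuclideanSpace ℝ (Fin d))}

lemma integrableOn_levyTruncation (hF : Integrable (fun x => min 1 ‖x‖) F)
    (K : Set (EuclideanSpace ℝ (Fin d))) : IntegrableOn levyTruncation K F :=
  (hF.mono' measurable_levyTruncation.aestronglyMeasurable
    (Eventually.of_forall norm_levyTruncation_le)).integrableOn

lemma re_sum_mul_nonpos {s : Fin d → ℂ} (hs : ∀ j, (s j).re ≤ 0)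
    {θ : EuclideanSpace ℝ (Fin d)} (hθ : ∀ j, 0 ≤ θ j) : (∑ j, s j * (θ j : ℂ)).re ≤ 0 := by
  rw [Complex.re_sum]
  refine Finset.sum_nonpos fun j _ => ?_
  rw [Complex.re_mul_ofReal]
  exact mul_nonpos_of_nonpos_of_nonneg (hs j) (hθ j)

lemma integrableOn_exp_sum_sub_one (hF : Integrable (fun x => min 1 ‖x‖) F) {s : Fin d → ℂ}
    (hs : ∀ j, (s j).re ≤ 0) :
    IntegrableOn (fun θ => Complex.exp (∑ j, s j * (θ j : ℂ)) - 1) (nonnegOrthant d) F := by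
  refine (hF.const_mul (2 + ∑ j, ‖s j‖)).integrableOn.mono'
    (Measurable.aestronglyMeasurable (by fun_prop)) ?_
  filter_upwards [ae_restrict_mem measurableSet_nonnegOrthant] with θ hθ
  refine norm_exp_sub_one_le_min (re_sum_mul_nonpos hs hθ)
    (Finset.sum_nonneg fun j _ => norm_nonneg _) (norm_nonneg _) ?_
  rw [Finset.sum_mul]
  refine norm_sum_le_of_le _ fun j _ => ?_
  rw [norm_mul, Complex.norm_real]
  exact mul_le_mul_of_nonneg_left (PiLp.norm_apply_le θ j) (norm_nonneg _)

lemma sum_I_mul_mul_eq_inner (x z : EuclideanSpace ℝ (Fin d)) :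
    ∑ j, Complex.I * (z j : ℂ) * (x j : ℂ) = Complex.I * (inner ℝ x z : ℝ) := by
  rw [PiLp.inner_apply]
  simp [Finset.mul_sum, mul_assoc]

/-- Once min(1,|x|) is integrable, so is χ; the compensator can be integrated separately and moved
into the drift, which becomes a₀. -/
lemma levyKhintchineExponent_eq_laplaceExponent {a : EuclideanSpace ℝ (Fin d)}
    (hF : Integrable (fun x => min 1 ‖x‖) F) (hK : ∀ᵐ x ∂F, x ∈ nonnegOrthant d)
    (z : EuclideanSpace ℝ (Fin d)) :
    levyKhintchineExponent a 0 F z = laplaceExponent a F fun j => Complex.I * (z j : ℂ) := by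
  have hr : F.restrict (nonnegOrthant d) = F := Measure.restrict_eq_self_of_ae_mem hK
  have hχ : Integrable levyTruncation F := by
    simpa using integrableOn_levyTruncation hF Set.univ
  have he := integrableOn_exp_sum_sub_one hF (s := fun j => Complex.I * (z j : ℂ)) (by simp)
  rw [IntegrableOn, hr] at he
  simp only [sum_I_mul_mul_eq_inner] at he
  have hd : ∑ j, (subordinatorDrift a F j : ℂ) * (Complex.I * (z j : ℂ))
      = Complex.I * (inner ℝ (subordinatorDrift a F) z : ℝ) := by
    rw [← sum_I_mul_mul_eq_inner]
    exact Finset.sum_congr rfl fun j _ => mul_comm _ _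
  have hi : ∫ x, Complex.I * ((inner ℝ (levyTruncation x) z : ℝ) : ℂ) ∂F
      = Complex.I * (inner ℝ (∫ x, levyTruncation x ∂F) z : ℝ) := by
    rw [integral_const_mul, integral_complex_ofReal, real_inner_comm, ← integral_inner hχ]
    simp_rw [real_inner_comm z]
  have hχi : Integrable (fun x => Complex.I * ((inner ℝ (levyTruncation x) z : ℝ) : ℂ)) F :=
    (hχ.inner_const z).ofReal.const_mul _
  unfold levyKhintchineExponent laplaceExponent
  simp only [hd, sum_I_mul_mul_eq_inner]
  rw [integral_sub he hχi, hi, hr, subordinatorDrift, hr, inner_sub_left]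
  simp
  ring

variable {Ω : Type*} [MeasurableSpace Ω] {P : Measure Ω} [IsProbabilityMeasure P]
  {Θ : ℝ≥0 → Ω → EuclideanSpace ℝ (Fin d)} {a : EuclideanSpace ℝ (Fin d)}
  {c : Matrix (Fin d) (Fin d) ℝ}

/-- The Laplace transform of a multivariate subordinator. -/
lemma IsMultivariateSubordinator.integral_exp_eq (hΘ : IsMultivariateSubordinator Θ P)
    (hT : IsLevyKhintchineTriplet Θ P a c F) (t : ℝ≥0) {s : Fin d → ℂ}
    (hs : ∀ j, (s j).re ≤ 0) :
    ∫ ω, Complex.exp (∑ j, s j * (Θ t ω j : ℂ)) ∂P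
      = Complex.exp ((t : ℝ) * laplaceExponent a F s) := by
  have hF := hΘ.integrable_min_one_norm hT
  have hK := hΘ.ae_mem_nonnegOrthant hT
  have hc := hΘ.gaussianPart_eq_zero hT
  have hexp := hT.isLevyExponent hΘ.1
  rw [hc] at hexp
  -- Writing s = iy - l with l ≥ 0, the family S(ζ) = iy - ζl reduces the problem to one complex
  -- variable: S(1) = s, while S(ix) = i(y - xl) is purely imaginary, where Lévy–Khintchine applies.
  let y : EuclideanSpace ℝ (Fin d) := WithLp.toLp 2 fun j => (s j).im
  let l : EuclideanSpace ℝ (Fin d) := WithLp.toLp 2 fun j => -(s j).re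
  have hl : ∀ j, 0 ≤ l j := fun j => neg_nonneg.2 (hs j)
  let S : ℂ → Fin d → ℂ := fun ζ j => Complex.I * (y j : ℂ) - ζ * (l j : ℂ)
  have hS1 : S 1 = s := by
    funext j
    simp only [S, y, l]
    conv_rhs => rw [← Complex.re_add_im (s j)]
    push_cast
    ring
  have hSre : ∀ ζ : ℂ, 0 ≤ ζ.re → ∀ j, (S ζ j).re ≤ 0 := by
    intro ζ hζ j
    have := mul_nonneg hζ (hl j)
    simpa [S] using this
  let b : EuclideanSpace ℝ (Fin d) → ℝ := fun θ => inner ℝ θ y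
  let m : EuclideanSpace ℝ (Fin d) → ℝ := fun θ => inner ℝ θ l
  have hbm : Measurable b := by fun_prop
  have hmm : Measurable m := by fun_prop
  have hm0 : ∀ θ ∈ nonnegOrthant d, 0 ≤ m θ := by
    intro θ hθ
    simp only [m, PiLp.inner_apply]
    exact Finset.sum_nonneg fun j _ => mul_nonneg (hl j) (hθ j)
  have hsum : ∀ (ζ : ℂ) (θ : EuclideanSpace ℝ (Fin d)),
      ∑ j, S ζ j * (θ j : ℂ) = Complex.I * b θ - ζ * m θ := by
    intro ζ θ
    simp only [S, b, m, PiLp.inner_apply, sub_mul, Finset.sum_sub_distrib]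
    simp [Finset.mul_sum, mul_assoc]
  set δ : ℝ := inner ℝ (subordinatorDrift a F) l with hδ
  have hdrift : ∀ ζ : ℂ, ∑ j, (subordinatorDrift a F j : ℂ) * S ζ j
      = Complex.I * b (subordinatorDrift a F) - ζ * δ := by
    intro ζ
    rw [← hsum]
    exact Finset.sum_congr rfl fun j _ => mul_comm _ _
  have hbmn : ∀ θ, |b θ| + m θ ≤ (‖y‖ + ‖l‖) * ‖θ‖ := by
    intro θ
    have h1 := abs_real_inner_le_norm θ y
    have h2 := (le_abs_self _).trans (abs_real_inner_le_norm θ l)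
    simp only [b, m]
    nlinarith
  have hdG : DiffContOnCl ℂ (fun ζ : ℂ =>
      ∫ θ in nonnegOrthant d, (Complex.exp (Complex.I * b θ - ζ * m θ) - 1) ∂F)
      {ζ | 0 < ζ.re} := by
    have hae : ∀ᵐ θ ∂F.restrict (nonnegOrthant d), 0 ≤ m θ := by
      filter_upwards [ae_restrict_mem measurableSet_nonnegOrthant] with θ hθ using hm0 θ hθ
    refine diffContOnCl_integral_exp_sub_one hbm hmm hae ?_
    refine (hF.integrableOn.const_mul (1 + (‖y‖ + ‖l‖))).mono'
      (Measurable.aestronglyMeasurable (by fun_prop)) ?_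
    filter_upwards [hae] with θ hθ
    rw [Real.norm_of_nonneg (by positivity)]
    have h1 := hbmn θ
    have hn : 0 ≤ ‖y‖ + ‖l‖ := by positivity
    rcases le_total 1 ‖θ‖ with h | h
    · rw [min_eq_left h]
      exact (min_le_left _ _).trans (by linarith)
    · rw [min_eq_right h]
      refine (min_le_right _ _).trans (h1.trans ?_)
      nlinarith [norm_nonneg θ]
  have hdA : DiffContOnCl ℂ (fun ζ : ℂ =>
      ∫ θ, (Complex.exp (Complex.I * b θ - ζ * m θ) - 1) ∂P.map (Θ t)) {ζ | 0 < ζ.re} := by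
    have hprob := Measure.isProbabilityMeasure_map (hΘ.1.aemeasurable t)
    have hae : ∀ᵐ θ ∂P.map (Θ t), 0 ≤ m θ := by
      rw [ae_map_iff (hΘ.1.aemeasurable t) (measurableSet_le measurable_const hmm)]
      filter_upwards [hΘ.ae_nonneg] with ω hω using hm0 _ (hω t)
    refine diffContOnCl_integral_exp_sub_one hbm hmm hae ?_
    refine (integrable_const (1 : ℝ)).mono' (Measurable.aestronglyMeasurable (by fun_prop)) ?_
    filter_upwards [hae] with θ hθ
    rw [Real.norm_of_nonneg (by positivity)]
    exact min_le_left _ _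
  have hA : ∀ ζ : ℂ, 0 ≤ ζ.re →
      ∫ θ, (Complex.exp (Complex.I * b θ - ζ * m θ) - 1) ∂P.map (Θ t) + 1
        = ∫ ω, Complex.exp (∑ j, S ζ j * (Θ t ω j : ℂ)) ∂P := by
    intro ζ hζ
    have hmeas : Measurable fun θ : EuclideanSpace ℝ (Fin d) =>
      Complex.exp (Complex.I * b θ - ζ * m θ) := by fun_prop
    rw [integral_map (hΘ.1.aemeasurable t) (hmeas.sub_const 1).aestronglyMeasurable]
    simp_rw [hsum]
    rw [integral_sub _ (integrable_const _)]
    · simp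
    · refine (integrable_const (1 : ℝ)).mono'
        (hmeas.comp_aemeasurable (hΘ.1.aemeasurable t)).aestronglyMeasurable ?_
      filter_upwards [hΘ.ae_nonneg] with ω hω
      refine norm_exp_le_one ?_
      rw [← hsum]
      exact re_sum_mul_nonpos (hSre ζ hζ) (hω t)
  have hL : ∀ ζ : ℂ, laplaceExponent a F (S ζ) = Complex.I * b (subordinatorDrift a F) - ζ * δ
      + ∫ θ in nonnegOrthant d, (Complex.exp (Complex.I * b θ - ζ * m θ) - 1) ∂F := by
    intro ζ
    simp only [laplaceExponent, hdrift, hsum]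
  -- The sign of the drift δ = ⟨a₀, l⟩ is not needed: the factor e^{-Bζ} offsets a possible growth
  -- of e^{-tζδ} and keeps f bounded by 2 on the closed half-plane.
  let B : ℝ := t * |δ|
  let f : ℂ → ℂ := fun ζ => Complex.exp (-(B * ζ)) *
    (∫ θ, (Complex.exp (Complex.I * b θ - ζ * m θ) - 1) ∂P.map (Θ t) + 1
      - Complex.exp ((t : ℝ) * (Complex.I * b (subordinatorDrift a F) - ζ * δ
      + ∫ θ in nonnegOrthant d, (Complex.exp (Complex.I * b θ - ζ * m θ) - 1) ∂F)))
  have hf : ∀ ζ : ℂ, 0 ≤ ζ.re → f ζ = Complex.exp (-(B * ζ)) *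
      (∫ ω, Complex.exp (∑ j, S ζ j * (Θ t ω j : ℂ)) ∂P
        - Complex.exp ((t : ℝ) * laplaceExponent a F (S ζ))) := by
    intro ζ hζ
    simp only [f]
    rw [hA ζ hζ, hL]
  have hfd : DiffContOnCl ℂ f {ζ | 0 < ζ.re} := by
    have h1 : Differentiable ℂ fun ζ : ℂ => Complex.exp (-(B * ζ)) := by fun_prop
    have h2 : Differentiable ℂ fun ζ : ℂ => Complex.I * b (subordinatorDrift a F) - ζ * δ := by
      fun_prop
    have h3 := ((h2.diffContOnCl.add hdG).const_smul ((t : ℝ) : ℂ))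
    exact h1.diffContOnCl.smul ((hdA.add_const 1).sub
      (Complex.differentiable_exp.comp_diffContOnCl h3))
  have hfb : ∀ ζ : ℂ, 0 ≤ ζ.re → ‖f ζ‖ ≤ 2 := by
    intro ζ hζ
    rw [hf ζ hζ, norm_mul, Complex.norm_exp]
    have hB : (-((B : ℂ) * ζ)).re = -(B * ζ.re) := by simp
    have hB0 : 0 ≤ B * ζ.re := mul_nonneg (by positivity) hζ
    have h1 : ‖∫ ω, Complex.exp (∑ j, S ζ j * (Θ t ω j : ℂ)) ∂P‖ ≤ 1 := by
      refine (norm_integral_le_of_norm_le_const (C := 1) ?_).trans (by simp)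
      filter_upwards [hΘ.ae_nonneg] with ω hω
      exact norm_exp_le_one (re_sum_mul_nonpos (hSre ζ hζ) (hω t))
    have h2 : ‖Complex.exp ((t : ℝ) * laplaceExponent a F (S ζ))‖ ≤ Real.exp (B * ζ.re) := by
      rw [Complex.norm_exp, Real.exp_le_exp, Complex.re_ofReal_mul, laplaceExponent, hdrift,
        Complex.add_re]
      have h3 : (∫ θ in nonnegOrthant d, (Complex.exp (∑ j, S ζ j * (θ j : ℂ)) - 1) ∂F).re ≤ 0 := by
        have h4 := Complex.reCLM.integral_comp_comm (integrableOn_exp_sum_sub_one hF (hSre ζ hζ))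
        simp only [Complex.reCLM_apply] at h4
        rw [← h4]
        refine integral_nonpos_of_ae ?_
        filter_upwards [ae_restrict_mem measurableSet_nonnegOrthant] with θ hθ
        have h5 := (Complex.re_le_norm _).trans
          (norm_exp_le_one (re_sum_mul_nonpos (hSre ζ hζ) hθ))
        simpa using h5
      have h4 : (Complex.I * (b (subordinatorDrift a F) : ℂ) - ζ * (δ : ℂ)).re
          = -(ζ.re * δ) := by simp
      rw [h4]
      have h5 : -(ζ.re * δ) ≤ |δ| * ζ.re := by
        nlinarith [neg_abs_le δ]
      calc (t : ℝ) * (-(ζ.re * δ) + _) ≤ t * (|δ| * ζ.re) :=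
            mul_le_mul_of_nonneg_left (by linarith) t.2
        _ = B * ζ.re := by ring
    have h6 : 1 ≤ Real.exp (B * ζ.re) := Real.one_le_exp hB0
    rw [hB]
    calc Real.exp (-(B * ζ.re)) * _ ≤ Real.exp (-(B * ζ.re)) *
          (Real.exp (B * ζ.re) + Real.exp (B * ζ.re)) :=
          mul_le_mul_of_nonneg_left ((norm_sub_le _ _).trans (add_le_add (h1.trans h6) h2))
            (Real.exp_nonneg _)
      _ = 2 * (Real.exp (-(B * ζ.re)) * Real.exp (B * ζ.re)) := by ring
      _ = 2 := by rw [← Real.exp_add, neg_add_cancel, Real.exp_zero, mul_one]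
  have hfi : ∀ x : ℝ, ‖f (x * Complex.I)‖ ≤ 0 := by
    intro x
    have hSi : S (x * Complex.I) = fun j => Complex.I * (((y - x • l) j : ℝ) : ℂ) := by
      funext j
      simp only [S, PiLp.sub_apply, PiLp.smul_apply, smul_eq_mul]
      push_cast
      ring
    rw [hf _ (by simp), hSi, ← levyKhintchineExponent_eq_laplaceExponent hF hK, ← hexp]
    simp only [sum_I_mul_mul_eq_inner]
    simp
  -- As f is bounded, growth order 1 < 2 with coefficient 0 is enough; the boundary bound 0 then
  -- propagates to ζ = 1.
  have hzero := PhragmenLindelof.right_half_plane_of_bounded_on_real (C := 0) hfd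
    ⟨1, by norm_num, 0, ?_⟩ ?_ hfi (z := 1) (by simp)
  · rw [norm_le_zero_iff, hf 1 (by simp), hS1] at hzero
    exact sub_eq_zero.1 ((mul_eq_zero.1 hzero).resolve_left (Complex.exp_ne_zero _))
  · refine Asymptotics.IsBigO.of_bound 2 ?_
    refine eventually_inf_principal.2 (Eventually.of_forall fun ζ hζ => ?_)
    simpa using hfb ζ (le_of_lt hζ)
  · refine isBoundedUnder_of_eventually_le (a := 2) ?_
    filter_upwards [eventually_ge_atTop 0] with x hx
    exact hfb x (by simpa using hx)

end LaplaceExponent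

/-! ### Càdlàg paths under a monotone time change. -/

section Cadlag

lemma IsCadlagPath.continuous_comp {E G : Type*} [TopologicalSpace E] [TopologicalSpace G]
    {f : ℝ≥0 → E} (hf : IsCadlagPath f) {g : E → G} (hg : Continuous g) :
    IsCadlagPath fun t => g (f t) := fun t => by
  obtain ⟨hr, l, hl⟩ := hf t
  exact ⟨hg.continuousAt.comp_continuousWithinAt hr, g l, (hg.tendsto l).comp hl⟩

lemma IsCadlagPath.pi {ι : Type*} {E : ι → Type*} [∀ i, TopologicalSpace (E i)]
    {f : ∀ i, ℝ≥0 → E i} (hf : ∀ i, IsCadlagPath (f i)) : IsCadlagPath fun t i => f i t := fun t =>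
  ⟨continuousWithinAt_pi.2 fun i => (hf i t).1, fun i => (hf i t).2.choose,
    tendsto_pi_nhds.2 fun i => (hf i t).2.choose_spec⟩

lemma IsCadlagPath.comp_monotone {E : Type*} [TopologicalSpace E] {f : ℝ≥0 → E} {θ : ℝ≥0 → ℝ≥0}
    (hf : IsCadlagPath f) (hθ : IsCadlagPath θ) (hmono : Monotone θ) :
    IsCadlagPath fun t => f (θ t) := fun t => by
  obtain ⟨hr, l, hl⟩ := hθ t
  refine ⟨(hf (θ t)).1.comp hr fun s hs => hmono hs, ?_⟩
  -- If θ reaches its left limit l before t, it is constant just before t and the composite tends to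
  -- f(l). Otherwise θ approaches l strictly from below and the left limit of f at l is the answer.
  by_cases h : ∃ s < t, l ≤ θ s
  · obtain ⟨s, hst, hs⟩ := h
    have : (𝓝[<] t).NeBot := nhdsLT_neBot_of_exists_lt ⟨s, hst⟩
    refine ⟨f l, tendsto_const_nhds.congr' ?_⟩
    filter_upwards [Ioo_mem_nhdsLT hst] with r hr
    have hle : θ r ≤ l := by
      refine ge_of_tendsto hl ?_
      filter_upwards [Ioo_mem_nhdsLT hr.2] with q hq using hmono hq.1.le
    rw [le_antisymm hle (hs.trans (hmono hr.1.le))]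
  · push Not at h
    obtain ⟨-, l', hl'⟩ := hf l
    exact ⟨l', hl'.comp (tendsto_nhdsWithin_iff.2 ⟨hl, eventually_nhdsWithin_of_forall h⟩)⟩

end Cadlag

/-! ### Stochastic continuity from stationarity. -/

section StochasticContinuity

variable {Ω E : Type*} [MeasurableSpace Ω] {P : Measure Ω} [IsFiniteMeasure P]
  [NormedAddCommGroup E] [MeasurableSpace E] [BorelSpace E] [SecondCountableTopology E]
  {X : ℝ≥0 → Ω → E}

/-- A process with stationary increments whose paths are right-continuous at `0` is stochastically
continuous. -/
lemma tendstoInMeasure_of_stationary_of_cadlag (hm : ∀ t, AEMeasurable (X t) P)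
    (hs : ∀ s h : ℝ≥0,
      IdentDistrib (fun ω => X (s + h) ω - X s ω) (fun ω => X h ω - X 0 ω) P P)
    (hc : ∀ᵐ ω ∂P, IsCadlagPath fun t => X t ω) (t : ℝ≥0) : TendstoInMeasure P X (𝓝 t) (X t) := by
  rw [tendstoInMeasure_iff_norm]
  intro ε hε
  have h0 : Tendsto (fun h => P {ω | ε ≤ ‖X h ω - X 0 ω‖}) (𝓝 0) (𝓝 0) := by
    refine tendsto_of_seq_tendsto fun u hu => ?_
    have hae : ∀ᵐ ω ∂P, Tendsto (fun n => X (u n) ω) atTop (𝓝 (X 0 ω)) := by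
      filter_upwards [hc] with ω hω
      have h1 := (hω 0).1.tendsto
      rw [show Set.Ici (0 : ℝ≥0) = Set.univ from Set.eq_univ_of_forall fun x => Set.mem_Ici.2 zero_le,
        nhdsWithin_univ] at h1
      exact h1.comp hu
    exact tendstoInMeasure_iff_norm.1
      (tendstoInMeasure_of_tendsto_ae (fun n => (hm (u n)).aestronglyMeasurable) hae) ε hε
  have hset : MeasurableSet {x : E | ε ≤ ‖x‖} := measurableSet_le measurable_const measurable_norm
  -- In `ℝ≥0` the sum of the two truncated differences is |s - t|, so stationarity reduces
  -- continuity at t to right-continuity at 0.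
  have heq : ∀ s, P {ω | ε ≤ ‖X s ω - X t ω‖}
      = P {ω | ε ≤ ‖X ((s - t) + (t - s)) ω - X 0 ω‖} := by
    intro s
    rcases le_total t s with h | h
    · have := (hs t (s - t)).measure_mem_eq hset
      rw [add_tsub_cancel_of_le h] at this
      rw [tsub_eq_zero_of_le h, add_zero]
      exact this
    · have := (hs s (t - s)).measure_mem_eq hset
      rw [add_tsub_cancel_of_le h] at this
      rw [tsub_eq_zero_of_le h, zero_add]
      simp_rw [norm_sub_rev (X s _)]
      exact this
  simp_rw [heq]
  have hd : Tendsto (fun s : ℝ≥0 => (s - t) + (t - s)) (𝓝 t) (𝓝 0) :=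
    Continuous.tendsto' (by fun_prop) t 0 (by simp)
  exact h0.comp hd

end StochasticContinuity

/-! ### Evaluation at an independent random index. -/

section RandomIndex

variable {Ω : Type*} [MeasurableSpace Ω] {P : Measure Ω}

lemma nullMeasurableSet_fiber {κ : Type*} [MeasurableSpace κ] [MeasurableSingletonClass κ]
    {N : Ω → κ} (hN : AEMeasurable N P) (k : κ) : NullMeasurableSet (N ⁻¹' {k}) P :=
  hN.nullMeasurable (measurableSet_singleton k)

lemma iUnion_fiber {α κ : Type*} (N : α → κ) : ⋃ k, N ⁻¹' {k} = Set.univ := by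
  ext x
  simp

lemma aestronglyMeasurable_randomIndex {κ G : Type*} [Countable κ] [MeasurableSpace κ]
    [MeasurableSingletonClass κ] [TopologicalSpace G] [TopologicalSpace.PseudoMetrizableSpace G]
    {Y : κ → Ω → G}
    (hY : ∀ k, AEStronglyMeasurable (Y k) P) {N : Ω → κ} (hN : AEMeasurable N P) :
    AEStronglyMeasurable (fun ω => Y (N ω) ω) P := by
  rw [← Measure.restrict_univ (μ := P), ← iUnion_fiber N, aestronglyMeasurable_iUnion_iff]
  intro k
  refine (hY k).restrict.congr ?_
  filter_upwards [ae_restrict_mem₀ (nullMeasurableSet_fiber hN k)] with ω hω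
  rw [show N ω = k from hω]

/-- For countably many index values, Ω splits into the fibres of N; on each one the index is
constant and independence factorises the integral. -/
lemma integral_randomIndex [IsProbabilityMeasure P] {κ : Type*} [Countable κ] [MeasurableSpace κ]
    [MeasurableSingletonClass κ] {Y : κ → Ω → ℂ} (hY : ∀ k, AEStronglyMeasurable (Y k) P)
    (hb : ∀ k ω, ‖Y k ω‖ ≤ 1) {N : Ω → κ} (hN : AEMeasurable N P)
    (hind : ∀ k, IndepFun (Y k) N P) :
    ∫ ω, Y (N ω) ω ∂P = ∫ ω, (∫ ω', Y (N ω) ω' ∂P) ∂P := by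
  have hnull := nullMeasurableSet_fiber hN
  have hdisj : Pairwise (Function.onFun (AEDisjoint P) fun k => N ⁻¹' {k}) := fun k l hkl =>
    Disjoint.aedisjoint (Disjoint.preimage N (by simpa using hkl))
  have hy : ∀ k, ‖∫ ω', Y k ω' ∂P‖ ≤ 1 := fun k =>
    (norm_integral_le_of_norm_le_const (Eventually.of_forall (hb k))).trans (by simp)
  have hi1 : Integrable (fun ω => Y (N ω) ω) P :=
    (integrable_const (1 : ℝ)).mono' (aestronglyMeasurable_randomIndex hY hN)
      (Eventually.of_forall fun ω => hb _ _)
  have hi2 : Integrable (fun ω => ∫ ω', Y (N ω) ω' ∂P) P :=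
    (integrable_const (1 : ℝ)).mono'
      (aestronglyMeasurable_randomIndex (Y := fun k _ => ∫ ω', Y k ω' ∂P)
        (fun k => aestronglyMeasurable_const) hN) (Eventually.of_forall fun ω => hy _)
  have h1 := hasSum_integral_iUnion_ae hnull hdisj hi1.integrableOn
  have h2 := hasSum_integral_iUnion_ae hnull hdisj hi2.integrableOn
  rw [iUnion_fiber, setIntegral_univ] at h1 h2
  refine h1.unique ?_
  convert h2 using 2 with k
  have h3 : ∫ ω in N ⁻¹' {k}, Y (N ω) ω ∂P = ∫ ω in N ⁻¹' {k}, Y k ω ∂P := by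
    refine integral_congr_ae ?_
    filter_upwards [ae_restrict_mem₀ (hnull k)] with ω hω
    rw [show N ω = k from hω]
  have h4 : ∫ ω in N ⁻¹' {k}, (∫ ω', Y (N ω) ω' ∂P) ∂P
      = ∫ ω in N ⁻¹' {k}, (∫ ω', Y k ω' ∂P) ∂P := by
    refine integral_congr_ae ?_
    filter_upwards [ae_restrict_mem₀ (hnull k)] with ω hω
    rw [show N ω = k from hω]
  rw [h3, h4, ← integral_indicator₀ (hnull k), ← integral_indicator₀ (hnull k)]
  have hind1 : ∀ ω, (N ⁻¹' {k}).indicator (Y k) ω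
      = (id (Y k ω)) * (Set.indicator {k} (fun _ => (1 : ℂ)) (N ω)) := by
    intro ω
    by_cases h : N ω = k <;> simp [Set.indicator, h]
  have hind2 : ∀ ω, (N ⁻¹' {k}).indicator (fun _ => ∫ ω', Y k ω' ∂P) ω
      = (∫ ω', Y k ω' ∂P) * (Set.indicator {k} (fun _ => (1 : ℂ)) (N ω)) := by
    intro ω
    by_cases h : N ω = k <;> simp [Set.indicator, h]
  simp_rw [hind1, hind2]
  rw [(hind k).integral_fun_comp_mul_comp (hY k).aemeasurable hN
    measurable_id.aestronglyMeasurable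
    ((measurable_const.indicator (measurableSet_singleton k)).aestronglyMeasurable),
    integral_const_mul]
  rfl

lemma measurable_natCeil_grid {ι : Type*} (n : ℕ) :
    Measurable fun (τ : ι → ℝ≥0) (i : ι) => ⌈τ i * ((n : ℝ≥0) + 1)⌉₊ :=
  measurable_pi_lambda _ fun i =>
    Nat.measurable_ceil.comp ((measurable_pi_apply i).mul_const _)

variable {ι : Type*} [Finite ι]

lemma aestronglyMeasurable_of_tendsto_upperGrid {G : Type*} [TopologicalSpace G]
    [TopologicalSpace.PseudoMetrizableSpace G] {Y : (ι → ℝ≥0) → Ω → G}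
    (hY : ∀ τ, AEStronglyMeasurable (Y τ) P)
    (hlim : ∀ᵐ ω ∂P, ∀ τ, Tendsto (fun n => Y (fun i => upperGrid n (τ i)) ω) atTop (𝓝 (Y τ ω)))
    {T : Ω → ι → ℝ≥0} (hT : AEMeasurable T P) :
    AEStronglyMeasurable (fun ω => Y (T ω) ω) P := by
  refine aestronglyMeasurable_of_tendsto_ae atTop
    (f := fun n ω => Y (fun i => upperGrid n (T ω i)) ω) (fun n => ?_) ?_
  · exact aestronglyMeasurable_randomIndex
      (Y := fun (k : ι → ℕ) => Y fun i => (k i : ℝ≥0) / (n + 1)) (fun k => hY _)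
      ((measurable_natCeil_grid n).comp_aemeasurable hT)
  · filter_upwards [hlim] with ω hω using hω _

/-- Freezing lemma: a family `Y τ`, right-continuous in `τ`, may be evaluated at an independent
random index `T` by first averaging over `Y` and then over `T`. -/
lemma integral_randomIndex_of_tendsto_upperGrid [IsProbabilityMeasure P]
    {Y : (ι → ℝ≥0) → Ω → ℂ} (hY : ∀ τ, AEStronglyMeasurable (Y τ) P)
    (hb : ∀ τ ω, ‖Y τ ω‖ ≤ 1)
    (hlim : ∀ᵐ ω ∂P, ∀ τ, Tendsto (fun n => Y (fun i => upperGrid n (τ i)) ω) atTop (𝓝 (Y τ ω)))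
    {T : Ω → ι → ℝ≥0} (hT : AEMeasurable T P) (hind : ∀ τ, IndepFun (Y τ) T P) :
    ∫ ω, Y (T ω) ω ∂P = ∫ ω, (∫ ω', Y (T ω) ω' ∂P) ∂P := by
  have hN : ∀ n : ℕ, AEMeasurable (fun ω i => ⌈T ω i * ((n : ℝ≥0) + 1)⌉₊) P := fun n =>
    (measurable_natCeil_grid n).comp_aemeasurable hT
  have hy : ∀ τ, ‖∫ ω', Y τ ω' ∂P‖ ≤ 1 := fun τ =>
    (norm_integral_le_of_norm_le_const (Eventually.of_forall (hb τ))).trans (by simp)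
  -- The rounded index is a function of T with countably many values, so the discrete case applies;
  -- dominated convergence then removes the rounding on both sides.
  have hstep : ∀ n : ℕ, ∫ ω, Y (fun i => upperGrid n (T ω i)) ω ∂P
      = ∫ ω, (∫ ω', Y (fun i => upperGrid n (T ω i)) ω' ∂P) ∂P := fun n =>
    integral_randomIndex (Y := fun (k : ι → ℕ) => Y fun i => (k i : ℝ≥0) / (n + 1))
      (fun k => hY _) (fun k => hb _) (hN n)
      (fun k => (hind _).comp measurable_id (measurable_natCeil_grid n))
  have hl : Tendsto (fun n => ∫ ω, Y (fun i => upperGrid n (T ω i)) ω ∂P) atTop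
      (𝓝 (∫ ω, Y (T ω) ω ∂P)) := by
    refine tendsto_integral_of_dominated_convergence (fun _ => 1) (fun n => ?_)
      (integrable_const _) (fun n => Eventually.of_forall fun ω => hb _ _) ?_
    · exact aestronglyMeasurable_randomIndex
        (Y := fun (k : ι → ℕ) => Y fun i => (k i : ℝ≥0) / (n + 1)) (fun k => hY _) (hN n)
    · filter_upwards [hlim] with ω hω using hω _
  have hr : Tendsto (fun n => ∫ ω, (∫ ω', Y (fun i => upperGrid n (T ω i)) ω' ∂P) ∂P) atTop
      (𝓝 (∫ ω, (∫ ω', Y (T ω) ω' ∂P) ∂P)) := by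
    refine tendsto_integral_of_dominated_convergence (fun _ => 1) (fun n => ?_)
      (integrable_const _) (fun n => Eventually.of_forall fun ω => hy _) ?_
    · exact aestronglyMeasurable_randomIndex
        (Y := fun (k : ι → ℕ) _ => ∫ ω', Y (fun i => (k i : ℝ≥0) / (n + 1)) ω' ∂P)
        (fun k => aestronglyMeasurable_const) (hN n)
    · refine Eventually.of_forall fun ω => ?_
      refine tendsto_integral_of_dominated_convergence (fun _ => 1) (fun n => hY _)
        (integrable_const _) (fun n => Eventually.of_forall fun ω => hb _ _) ?_
      filter_upwards [hlim] with ω' hω' using hω' _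
  simp_rw [hstep] at hl
  exact tendsto_nhds_unique hl hr

end RandomIndex

/-! ### Characteristic functions of Lévy processes. -/

section CharacteristicFunction

variable {Ω : Type*} [MeasurableSpace Ω] {P : Measure Ω}

lemma norm_exp_I_mul_ofReal_le_one (x : ℝ) : ‖Complex.exp (Complex.I * x)‖ ≤ 1 :=
  norm_exp_le_one (by simp)

lemma continuous_exp_I_mul_inner {E : Type*} [NormedAddCommGroup E] [InnerProductSpace ℝ E]
    (u : E) : Continuous fun x : E => Complex.exp (Complex.I * (inner ℝ x u : ℝ)) := by
  fun_prop

/-- The characteristic function of `X t` is Borel in `t` for a Lévy process `X`. -/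
lemma IsLevyProcess.measurable_integral_exp [IsProbabilityMeasure P] {E : Type*}
    [NormedAddCommGroup E]
    [InnerProductSpace ℝ E] [MeasurableSpace E] [BorelSpace E] {X : ℝ≥0 → Ω → E}
    (hX : IsLevyProcess X P) (u : E) :
    Measurable fun t => ∫ ω, Complex.exp (Complex.I * (inner ℝ (X t ω) u : ℝ)) ∂P := by
  refine measurable_of_tendsto_metrizable
    (f := fun n t => ∫ ω, Complex.exp (Complex.I * (inner ℝ (X (upperGrid n t) ω) u : ℝ)) ∂P)
    (fun n => ?_) (tendsto_pi_nhds.2 fun t => ?_)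
  · have h : Measurable fun k : ℕ =>
      ∫ ω, Complex.exp (Complex.I * (inner ℝ (X ((k : ℝ≥0) / (n + 1)) ω) u : ℝ)) ∂P :=
      measurable_from_nat
    exact h.comp (Nat.measurable_ceil.comp (measurable_id.mul_const _))
  · refine tendsto_integral_of_dominated_convergence (fun _ => 1) (fun n => ?_)
      (integrable_const _)
      (fun n => Eventually.of_forall fun ω => norm_exp_I_mul_ofReal_le_one _) ?_
    · exact ((continuous_exp_I_mul_inner u).measurable.comp_aemeasurable
        (hX.aemeasurable _)).aestronglyMeasurable
    · filter_upwards [hX.tendsto_upperGrid] with ω hω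
      exact ((continuous_exp_I_mul_inner u).tendsto _).comp (hω t)

lemma charFun_map_eq_integral {E : Type*} [NormedAddCommGroup E] [InnerProductSpace ℝ E]
    [MeasurableSpace E] [OpensMeasurableSpace E] [SecondCountableTopology E] {Z : Ω → E}
    (hZ : AEMeasurable Z P) (u : E) :
    charFun (P.map Z) u = ∫ ω, Complex.exp (Complex.I * (inner ℝ (Z ω) u : ℝ)) ∂P := by
  rw [charFun_apply, integral_map hZ (Continuous.aestronglyMeasurable (by fun_prop))]
  simp_rw [mul_comm _ Complex.I]

lemma IsLevyProcess.integral_prod_exp_increments {E : Type*} [NormedAddCommGroup E]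
    [InnerProductSpace ℝ E] [MeasurableSpace E] [BorelSpace E] [SecondCountableTopology E]
    {X : ℝ≥0 → Ω → E} (hX : IsLevyProcess X P) {n : ℕ} {τ : Fin (n + 1) → ℝ≥0} (hτ : Monotone τ)
    (u : Fin n → E) :
    ∫ ω, ∏ i : Fin n, Complex.exp (Complex.I *
        (inner ℝ (X (τ i.succ) ω - X (τ i.castSucc) ω) (u i) : ℝ)) ∂P
      = ∏ i : Fin n, ∫ ω, Complex.exp (Complex.I *
        (inner ℝ (X (τ i.succ - τ i.castSucc) ω) (u i) : ℝ)) ∂P := by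
  have h := (hX.indepIncrements n τ hτ).integral_fun_prod_comp
    (f := fun i x => Complex.exp (Complex.I * (inner ℝ x (u i) : ℝ)))
    (fun i => (hX.aemeasurable _).sub (hX.aemeasurable _))
    (fun i => (continuous_exp_I_mul_inner (u i)).aestronglyMeasurable)
  rw [h]
  refine Finset.prod_congr rfl fun i _ => ?_
  have hid := hX.identDistrib_sub (τ i.castSucc) (τ i.succ - τ i.castSucc)
  rw [add_tsub_cancel_of_le (hτ (Fin.castSucc_le_succ i))] at hid
  exact (hid.comp (continuous_exp_I_mul_inner (u i)).measurable).integral_eq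

lemma IsLevyExponent.re_nonpos [IsProbabilityMeasure P] {E : Type*} [NormedAddCommGroup E]
    [InnerProductSpace ℝ E]
    {X : ℝ≥0 → Ω → E} {φ : E → ℂ} (hφ : IsLevyExponent X P φ) (u : E) : (φ u).re ≤ 0 := by
  have h : ‖∫ ω, Complex.exp (Complex.I * (inner ℝ (X 1 ω) u : ℝ)) ∂P‖ ≤ 1 :=
    (norm_integral_le_of_norm_le_const
      (Eventually.of_forall fun ω => norm_exp_I_mul_ofReal_le_one _)).trans (by simp)
  rw [hφ 1 u, Complex.norm_exp, Real.exp_le_one_iff] at h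
  simpa using h

end CharacteristicFunction

/-! ### The subordinated process. -/

section Subordination

lemma exp_inner_subordinatedProcess_sub {Ω : Type*} {d : ℕ} {H : Fin d → Type*}
    [∀ j, NormedAddCommGroup (H j)] [∀ j, InnerProductSpace ℝ (H j)] {L : ∀ j, ℝ≥0 → Ω → H j}
    {Θ : ℝ≥0 → Ω → EuclideanSpace ℝ (Fin d)} (s t : ℝ≥0) (ω : Ω) (u : PiLp 2 H) :
    Complex.exp (Complex.I *
        (inner ℝ (subordinatedProcess L Θ t ω - subordinatedProcess L Θ s ω) u : ℝ))
      = ∏ j, Complex.exp (Complex.I *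
        (inner ℝ (L j (Θ t ω j).toNNReal ω - L j (Θ s ω j).toNNReal ω) (u j) : ℝ)) := by
  rw [← Complex.exp_sum, PiLp.inner_apply, Complex.ofReal_sum, Finset.mul_sum]
  rfl

variable {Ω : Type*} [MeasurableSpace Ω] {P : Measure Ω} {d : ℕ} {H : Fin d → Type*}
  [∀ j, NormedAddCommGroup (H j)] [∀ j, MeasurableSpace (H j)]
  {L : ∀ j, ℝ≥0 → Ω → H j} {Θ : ℝ≥0 → Ω → EuclideanSpace ℝ (Fin d)}

lemma measurable_toNNReal_family {κ : Type*} (t : κ → ℝ≥0) :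
    Measurable fun (p : ℝ≥0 → EuclideanSpace ℝ (Fin d)) (i : κ × Fin d) =>
      (p (t i.1) i.2).toNNReal := by
  refine measurable_pi_lambda _ fun i => Measurable.real_toNNReal ?_
  have h : Measurable fun x : EuclideanSpace ℝ (Fin d) => x i.2 := by fun_prop
  exact h.comp (measurable_pi_apply (t i.1))

lemma aemeasurable_toNNReal_family {κ : Type*} [Finite κ] (hΘ : ∀ t, AEMeasurable (Θ t) P)
    (t : κ → ℝ≥0) :
    AEMeasurable (fun ω (i : κ × Fin d) => (Θ (t i.1) ω i.2).toNNReal) P := by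
  refine aemeasurable_pi_lambda _ fun i => AEMeasurable.real_toNNReal ?_
  have h : Measurable fun x : EuclideanSpace ℝ (Fin d) => x i.2 := by fun_prop
  exact h.comp_aemeasurable (hΘ _)

lemma aemeasurable_subordinatedProcess [∀ j, BorelSpace (H j)]
    [∀ j, SecondCountableTopology (H j)] (hL : ∀ j, IsLevyProcess (L j) P)
    (hΘ : ∀ t, AEMeasurable (Θ t) P) (t : ℝ≥0) : AEMeasurable (subordinatedProcess L Θ t) P := by
  have hj : ∀ j, AEMeasurable (fun ω => L j (Θ t ω j).toNNReal ω) P := by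
    intro j
    refine AEStronglyMeasurable.aemeasurable ?_
    have hT : AEMeasurable (fun ω (_ : Unit) => (Θ t ω j).toNNReal) P :=
      aemeasurable_pi_lambda _ fun _ => AEMeasurable.real_toNNReal
        ((by fun_prop : Measurable fun x : EuclideanSpace ℝ (Fin d) => x j).comp_aemeasurable
          (hΘ t))
    refine aestronglyMeasurable_of_tendsto_upperGrid (Y := fun τ : Unit → ℝ≥0 => L j (τ ()))
      (fun τ => ((hL j).aemeasurable _).aestronglyMeasurable) ?_ hT
    filter_upwards [(hL j).tendsto_upperGrid] with ω hω τ using hω _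
  exact (WithLp.measurable_toLp 2 _).comp_aemeasurable (aemeasurable_pi_lambda _ hj)

lemma isCadlagPath_subordinatedProcess (hL : ∀ j, IsLevyProcess (L j) P)
    (hΘ : IsMultivariateSubordinator Θ P) :
    ∀ᵐ ω ∂P, IsCadlagPath fun t => subordinatedProcess L Θ t ω := by
  filter_upwards [ae_all_iff.2 fun j => (hL j).cadlag, ae_all_iff.2 fun j => (hΘ.2 j).1.cadlag,
    hΘ.ae_monotone] with ω h1 h2 h3
  refine IsCadlagPath.continuous_comp (IsCadlagPath.pi fun j => ?_) (PiLp.continuous_toLp 2 H)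
  exact (h1 j).comp_monotone ((h2 j).continuous_comp continuous_real_toNNReal)
    fun s t hst => Real.toNNReal_le_toNNReal (h3 j hst)

lemma subordinatedProcess_zero_ae (hL : ∀ j, IsLevyProcess (L j) P)
    (hΘ : IsMultivariateSubordinator Θ P) : ∀ᵐ ω ∂P, subordinatedProcess L Θ 0 ω = 0 := by
  filter_upwards [ae_all_iff.2 fun j => (hL j).zero, hΘ.1.zero] with ω h1 h2
  ext j
  simp [subordinatedProcess, h1, h2]

variable [∀ j, InnerProductSpace ℝ (H j)]

/-- The characteristic function at `u` of `(L₁(v₁), …, L_d(v_d))` for deterministic times `v`. -/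
def fixedTimeCharFun (P : Measure Ω) (L : ∀ j, ℝ≥0 → Ω → H j) (v : EuclideanSpace ℝ (Fin d))
    (u : PiLp 2 H) : ℂ :=
  ∏ j, ∫ ω, Complex.exp (Complex.I * (inner ℝ (L j (v j).toNNReal ω) (u j) : ℝ)) ∂P

variable [IsProbabilityMeasure P] [∀ j, BorelSpace (H j)]

lemma measurable_fixedTimeCharFun (hL : ∀ j, IsLevyProcess (L j) P) (u : PiLp 2 H) :
    Measurable fun v => fixedTimeCharFun P L v u := by
  refine Finset.measurable_fun_prod _ fun j _ => ?_
  have h : Measurable fun v : EuclideanSpace ℝ (Fin d) => v j := by fun_prop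
  exact ((hL j).measurable_integral_exp (u j)).comp h.real_toNNReal

variable [∀ j, SecondCountableTopology (H j)]

/-- Joint characteristic function of the increments of the subordinated process. -/
lemma integral_prod_exp_subordinatedProcess (hL : ∀ j, IsLevyProcess (L j) P)
    (hLindep : iIndepFun (fun j ω (t : ℝ≥0) => L j t ω) P)
    (hΘ : IsMultivariateSubordinator Θ P)
    (hLΘ : IndepFun (fun ω (j : Fin d) (t : ℝ≥0) => L j t ω) (fun ω (t : ℝ≥0) => Θ t ω) P)
    {n : ℕ} {t : Fin (n + 1) → ℝ≥0} (ht : Monotone t) (u : Fin n → PiLp 2 H) :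
    ∫ ω, ∏ i : Fin n, Complex.exp (Complex.I * (inner ℝ (subordinatedProcess L Θ (t i.succ) ω
        - subordinatedProcess L Θ (t i.castSucc) ω) (u i) : ℝ)) ∂P
      = ∏ i : Fin n, ∫ ω, fixedTimeCharFun P L (Θ (t i.succ) ω - Θ (t i.castSucc) ω) (u i) ∂P := by
  -- A functional on path space reading finitely many times, so that both independence hypotheses,
  -- which concern whole paths, apply by composition.
  let Φ : ∀ (j : Fin d) (τ : Fin (n + 1) × Fin d → ℝ≥0), (ℝ≥0 → H j) → ℂ := fun j τ p =>
    ∏ i : Fin n, Complex.exp (Complex.I *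
      (inner ℝ (p (τ (i.succ, j)) - p (τ (i.castSucc, j))) (u i j) : ℝ))
  let Y : (Fin (n + 1) × Fin d → ℝ≥0) → Ω → ℂ := fun τ ω => ∏ j, Φ j τ fun t => L j t ω
  let T : Ω → Fin (n + 1) × Fin d → ℝ≥0 := fun ω i => (Θ (t i.1) ω i.2).toNNReal
  have hΦ : ∀ j τ, Measurable (Φ j τ) := fun j τ =>
    Finset.measurable_fun_prod _ fun i _ => (continuous_exp_I_mul_inner (u i j)).measurable.comp
      ((measurable_pi_apply _).sub (measurable_pi_apply _))
  have hΦL : ∀ j τ, AEStronglyMeasurable (fun ω => Φ j τ fun t => L j t ω) P := fun j τ => by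
    refine AEMeasurable.aestronglyMeasurable (Finset.aemeasurable_fun_prod _ fun i _ => ?_)
    exact (continuous_exp_I_mul_inner (u i j)).measurable.comp_aemeasurable
      (((hL j).aemeasurable _).sub ((hL j).aemeasurable _))
  have hY : ∀ τ, AEStronglyMeasurable (Y τ) P := fun τ =>
    Finset.aestronglyMeasurable_fun_prod _ fun j _ => hΦL j τ
  have hb : ∀ τ ω, ‖Y τ ω‖ ≤ 1 := fun τ ω => by
    simp only [Y, Φ, norm_prod]
    exact Finset.prod_le_one (fun j _ => Finset.prod_nonneg fun i _ => norm_nonneg _) fun j _ =>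
      Finset.prod_le_one (fun i _ => norm_nonneg _) fun i _ => norm_exp_I_mul_ofReal_le_one _
  have hlim : ∀ᵐ ω ∂P, ∀ τ, Tendsto (fun n => Y (fun i => upperGrid n (τ i)) ω) atTop
      (𝓝 (Y τ ω)) := by
    filter_upwards [ae_all_iff.2 fun j => (hL j).tendsto_upperGrid] with ω hω τ
    exact tendsto_finsetProd _ fun j _ => tendsto_finsetProd _ fun i _ =>
      ((continuous_exp_I_mul_inner (u i j)).tendsto _).comp ((hω j _).sub (hω j _))
  have hT : AEMeasurable T P := aemeasurable_toNNReal_family hΘ.1.aemeasurable t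
  have hind : ∀ τ, IndepFun (Y τ) T P := fun τ =>
    hLΘ.comp (φ := fun p : ∀ j, ℝ≥0 → H j => ∏ j, Φ j τ (p j))
      (Finset.measurable_fun_prod _ fun j _ => (hΦ j τ).comp (measurable_pi_apply j))
      (measurable_toNNReal_family t)
  -- Only times increasing in i for each j give genuine increments of L_j; the index T(ω) has this
  -- property almost surely because Θ is monotone.
  have hmean : ∀ τ : Fin (n + 1) × Fin d → ℝ≥0, (∀ j, Monotone fun i => τ (i, j)) →
      ∫ ω, Y τ ω ∂P = ∏ j, ∏ i : Fin n, ∫ ω, Complex.exp (Complex.I *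
        (inner ℝ (L j (τ (i.succ, j) - τ (i.castSucc, j)) ω) (u i j) : ℝ)) ∂P := by
    intro τ hτ
    have h := (hLindep.comp (fun j => Φ j τ) fun j => hΦ j τ).integral_fun_prod_eq_prod_integral
      fun j => hΦL j τ
    refine h.trans (Finset.prod_congr rfl fun j _ => ?_)
    exact (hL j).integral_prod_exp_increments (hτ j) fun i => u i j
  have hlhs : ∀ ω, ∏ i : Fin n, Complex.exp (Complex.I *
      (inner ℝ (subordinatedProcess L Θ (t i.succ) ω
        - subordinatedProcess L Θ (t i.castSucc) ω) (u i) : ℝ)) = Y (T ω) ω := by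
    intro ω
    simp_rw [exp_inner_subordinatedProcess_sub]
    exact Finset.prod_comm
  simp_rw [hlhs]
  rw [integral_randomIndex_of_tendsto_upperGrid hY hb hlim hT hind]
  have hrhs : (fun ω => ∫ ω', Y (T ω) ω' ∂P) =ᵐ[P] fun ω =>
      ∏ i : Fin n, fixedTimeCharFun P L (Θ (t i.succ) ω - Θ (t i.castSucc) ω) (u i) := by
    filter_upwards [hΘ.ae_monotone, hΘ.ae_nonneg] with ω hmono hnn
    rw [hmean (T ω) fun j i k hik => Real.toNNReal_le_toNNReal (hmono j (ht hik)),
      Finset.prod_comm]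
    refine Finset.prod_congr rfl fun i _ => Finset.prod_congr rfl fun j _ => ?_
    simp only [T, PiLp.sub_apply]
    rw [NNReal.sub_def, Real.coe_toNNReal _ (hnn _ _), Real.coe_toNNReal _ (hnn _ _)]
  rw [integral_congr_ae hrhs]
  -- Each factor now depends on a single increment of Θ, so independence of these increments takes
  -- the product out of the expectation.
  exact (hΘ.1.indepIncrements n t ht).integral_fun_prod_comp
    (f := fun i v => fixedTimeCharFun P L v (u i))
    (fun i => (hΘ.1.aemeasurable _).sub (hΘ.1.aemeasurable _))
    (fun i => (measurable_fixedTimeCharFun hL (u i)).aestronglyMeasurable)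

lemma integral_exp_subordinatedProcess_sub (hL : ∀ j, IsLevyProcess (L j) P)
    (hLindep : iIndepFun (fun j ω (t : ℝ≥0) => L j t ω) P)
    (hΘ : IsMultivariateSubordinator Θ P)
    (hLΘ : IndepFun (fun ω (j : Fin d) (t : ℝ≥0) => L j t ω) (fun ω (t : ℝ≥0) => Θ t ω) P)
    {s t : ℝ≥0} (hst : s ≤ t) (u : PiLp 2 H) :
    ∫ ω, Complex.exp (Complex.I * (inner ℝ (subordinatedProcess L Θ t ω
        - subordinatedProcess L Θ s ω) u : ℝ)) ∂P
      = ∫ ω, fixedTimeCharFun P L (Θ t ω - Θ s ω) u ∂P := by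
  have hmono : Monotone ![s, t] := by
    rw [Fin.monotone_iff_le_succ]
    intro i
    fin_cases i
    simpa using hst
  simpa using integral_prod_exp_subordinatedProcess hL hLindep hΘ hLΘ hmono fun _ => u

lemma isLevyProcess_subordinatedProcess [∀ j, CompleteSpace (H j)]
    (hL : ∀ j, IsLevyProcess (L j) P)
    (hLindep : iIndepFun (fun j ω (t : ℝ≥0) => L j t ω) P)
    (hΘ : IsMultivariateSubordinator Θ P)
    (hLΘ : IndepFun (fun ω (j : Fin d) (t : ℝ≥0) => L j t ω) (fun ω (t : ℝ≥0) => Θ t ω) P) :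
    IsLevyProcess (subordinatedProcess L Θ) P := by
  have hm := aemeasurable_subordinatedProcess hL hΘ.1.aemeasurable
  have hc := isCadlagPath_subordinatedProcess hL hΘ
  have hsub : ∀ s t, AEMeasurable
      (fun ω => subordinatedProcess L Θ t ω - subordinatedProcess L Θ s ω) P :=
    fun s t => (hm t).sub (hm s)
  have hstat : ∀ s h : ℝ≥0, IdentDistrib
      (fun ω => subordinatedProcess L Θ (s + h) ω - subordinatedProcess L Θ s ω)
      (fun ω => subordinatedProcess L Θ h ω - subordinatedProcess L Θ 0 ω) P P := by
    intro s h
    refine ⟨hsub _ _, hsub _ _, ?_⟩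
    have h1 := Measure.isProbabilityMeasure_map (hsub s (s + h))
    have h2 := Measure.isProbabilityMeasure_map (hsub 0 h)
    refine Measure.ext_of_charFun (funext fun u => ?_)
    rw [charFun_map_eq_integral (hsub _ _), charFun_map_eq_integral (hsub _ _),
      integral_exp_subordinatedProcess_sub hL hLindep hΘ hLΘ le_self_add,
      integral_exp_subordinatedProcess_sub hL hLindep hΘ hLΘ zero_le]
    exact ((hΘ.1.stationaryIncrements s h).comp (measurable_fixedTimeCharFun hL u)).integral_eq
  refine ⟨hm, subordinatedProcess_zero_ae hL hΘ, fun n t ht => ?_, hstat,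
    tendstoInMeasure_of_stationary_of_cadlag hm hstat hc, hc⟩
  -- Independence becomes factorisation of the joint characteristic function; comparing with the
  -- one-increment case, each factor is the characteristic function of an increment of X.
  rw [iIndepFun_iff_charFun_pi fun i => hsub _ _]
  intro u
  have hv : AEMeasurable (fun ω => WithLp.toLp 2 fun i : Fin n =>
      subordinatedProcess L Θ (t i.succ) ω - subordinatedProcess L Θ (t i.castSucc) ω) P :=
    (WithLp.measurable_toLp 2 _).comp_aemeasurable (aemeasurable_pi_lambda _ fun i => hsub _ _)
  rw [charFun_map_eq_integral hv]
  simp_rw [charFun_map_eq_integral (hsub _ _),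
    integral_exp_subordinatedProcess_sub hL hLindep hΘ hLΘ (ht (Fin.castSucc_le_succ _))]
  rw [← integral_prod_exp_subordinatedProcess hL hLindep hΘ hLΘ ht]
  simp_rw [PiLp.inner_apply, Complex.ofReal_sum, Finset.mul_sum, Complex.exp_sum]

lemma isLevyExponent_subordinatedProcess (hL : ∀ j, IsLevyProcess (L j) P)
    (hLindep : iIndepFun (fun j ω (t : ℝ≥0) => L j t ω) P)
    (hΘ : IsMultivariateSubordinator Θ P)
    (hLΘ : IndepFun (fun ω (j : Fin d) (t : ℝ≥0) => L j t ω) (fun ω (t : ℝ≥0) => Θ t ω) P)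
    {φ : ∀ j, H j → ℂ} (hφ : ∀ j, IsLevyExponent (L j) P (φ j)) {a : EuclideanSpace ℝ (Fin d)}
    {c : Matrix (Fin d) (Fin d) ℝ} {F : Measure (EuclideanSpace ℝ (Fin d))}
    (hT : IsLevyKhintchineTriplet Θ P a c F) :
    IsLevyExponent (subordinatedProcess L Θ) P
      fun u => laplaceExponent a F fun j => φ j (u j) := by
  intro t u
  rw [← hΘ.integral_exp_eq hT t fun j => (hφ j).re_nonpos (u j)]
  have h1 : (fun ω => Complex.exp (Complex.I * (inner ℝ (subordinatedProcess L Θ t ω) u : ℝ)))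
      =ᵐ[P] fun ω => Complex.exp (Complex.I * (inner ℝ (subordinatedProcess L Θ t ω
        - subordinatedProcess L Θ 0 ω) u : ℝ)) := by
    filter_upwards [subordinatedProcess_zero_ae hL hΘ] with ω hω
    rw [hω, sub_zero]
  rw [integral_congr_ae h1, integral_exp_subordinatedProcess_sub hL hLindep hΘ hLΘ zero_le]
  refine integral_congr_ae ?_
  filter_upwards [hΘ.1.zero, hΘ.ae_nonneg] with ω h0 hnn
  rw [h0, sub_zero, fixedTimeCharFun, Complex.exp_sum]
  refine Finset.prod_congr rfl fun j _ => ?_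
  -- The frozen characteristic function of L_j at time Θ_j(t) is exp(Θ_j(t) φ_j(u_j)), the integrand
  -- of the Laplace transform at s_j = φ_j(u_j).
  rw [hφ j, Real.coe_toNNReal _ (hnn t j), mul_comm]

end Subordination

end

theorem theorem2p3 {Ω : Type*} [MeasurableSpace Ω] (P : Measure Ω) [IsProbabilityMeasure P]
    {d : ℕ} {H : Fin d → Type*}
    [∀ j, NormedAddCommGroup (H j)] [∀ j, InnerProductSpace ℝ (H j)]
    [∀ j, CompleteSpace (H j)] [∀ j, TopologicalSpace.SeparableSpace (H j)]
    [∀ j, MeasurableSpace (H j)] [∀ j, BorelSpace (H j)]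
    (L : ∀ j, ℝ≥0 → Ω → H j) (Θ : ℝ≥0 → Ω → EuclideanSpace ℝ (Fin d))
    (hL : ∀ j, IsLevyProcess (L j) P)
    (hLindep : iIndepFun (fun j ω (t : ℝ≥0) => L j t ω) P)
    (hΘ : IsMultivariateSubordinator Θ P)
    (hLΘ : IndepFun (fun ω (j : Fin d) (t : ℝ≥0) => L j t ω) (fun ω (t : ℝ≥0) => Θ t ω) P) :
    IsLevyProcess (subordinatedProcess L Θ) P ∧
    ∀ φ : ∀ j, H j → ℂ, (∀ j, IsLevyExponent (L j) P (φ j)) →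
    ∀ (a : EuclideanSpace ℝ (Fin d)) (c : Matrix (Fin d) (Fin d) ℝ)
      (F : Measure (EuclideanSpace ℝ (Fin d))), IsLevyKhintchineTriplet Θ P a c F →
      -- the objects entering the formula are well defined
      IntegrableOn levyTruncation (nonnegOrthant d) F ∧
      (∀ j u, (φ j u).re ≤ 0) ∧
      (∀ s : Fin d → ℂ, (∀ j, (s j).re ≤ 0) →
        IntegrableOn (fun θ => Complex.exp (∑ j, s j * (θ j : ℂ)) - 1) (nonnegOrthant d) F) ∧
      -- the Lévy exponent of the subordinated process
      IsLevyExponent (subordinatedProcess L Θ) P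
        (fun u => laplaceExponent a F (fun j => φ j (u j))) := by
  have : ∀ j, SecondCountableTopology (H j) := fun j =>
    UniformSpace.secondCountable_of_separable (H j)
  refine ⟨isLevyProcess_subordinatedProcess hL hLindep hΘ hLΘ, fun φ hφ a c F hT => ?_⟩
  have hF := hΘ.integrable_min_one_norm hT
  exact ⟨integrableOn_levyTruncation hF _, fun j u => (hφ j).re_nonpos u,
    fun s hs => integrableOn_exp_sum_sub_one hF hs,
    isLevyExponent_subordinatedProcess hL hLindep hΘ hLΘ hφ hT⟩
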